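/- Let $p$ be a prime and let $(R,\mathfrak m,k)$ be a noetherian local domain of characteristic $p$ that is $F$-finite (i.e. its Frobenius endomorphism is finite). For an $R$-module $M$ and $e\ge 0$ let $F^e_*M$ denote $M$ with $R$ acting through the $e$-th iterated Frobenius, $r\cdot F^e_*m=F^e_*(r^{p^e}m)$. Let $\mathcal C=\bigoplus_e \mathcal C_e$ be a Cartier subalgebra of $\mathcal C_R=\bigoplus_{e\ge 0}\operatorname{Hom}_R(F^e_*R,R)$; that is, each $\mathcal C_e\subseteq \operatorname{Hom}_R(F^e_*R,R)$ is an $R$-submodule (for post-multiplication), $\mathcal C_0=\operatorname{Hom}_R(R,R)=R$, and $\varphi\circ F^d_*\psi\in\mathcal C_{d+e}$ for all $\varphi\in\mathcal C_d$, $\psi\in\mathcal C_e$. For a finite $R$-module $M$ and a graded left $\mathcal C$-submodule $\mathcal M=\bigoplus_e\mathcal M_e$ of $M^\flat=\bigoplus_e \operatorname{Hom}_R(F^e_*M,R)$ (with $\mathcal C$ acting by $\varphi\cdot\vartheta=\varphi\circ F^d_*\vartheta$ for $\varphi\in\mathcal C_d$), put $$a_e(\mathcal M)=\operatorname{length}_R\bigl(\mathcal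 M_e/(\mathcal M_e\cap \operatorname{Hom}_R(F^e_*M,\mathfrak m))\bigr),\quad n_{\mathcal M}=\gcd\{e\mid a_e(\mathcal M)\ne 0\},\quad \delta=\dim R+\log_p[k^{1/p}:k].$$ The splitting ratio of $\mathcal M$ is $$\operatorname{asr}(\mathcal M)=\lim_{e\to\infty}\frac{a_{e n_{\mathcal M}}(\mathcal M)}{p^{\,e n_{\mathcal M}\delta}}\ \text{ if } n_{\mathcal M}\neq 0,$$ and $\operatorname{asr}(\mathcal M)=0$ if $n_{\mathcal M}=0$, i.e. if $a_e(\mathcal M)=0$ for all $e>0$. The $F$-signature of $(R,\mathcal C)$ is $s(R,\mathcal C)=\operatorname{asr}(\mathcal C)$, where $\mathcal C\subseteq R^\flat=\mathcal C_R$ is viewed as a graded left module over itself. Finally, let $M^\natural\subseteq M^\flat$ be the graded left $\mathcal C$-submodule whose degree-$e$ part is the additive subgroup of $\operatorname{Hom}_R(F^e_*M,R)$ generated by the maps $\varphi\circ F^e_*\rho$ with $\varphi\in\mathcal C_e$ and $\rho\in M^\vee=\operatorname{Hom}_R(M,R)$. Theorem. For every finite $R$-module $M$, the limits defining $s(R,\mathcal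 C)$ and $\operatorname{asr}(M^\natural)$ exist, and $$\operatorname{asr}(M^\natural)=\operatorname{rank} M\cdot s(R,\mathcal C).$$ -/

import Mathlib

set_option maxSynthPendingDepth 3

open Filter Topology

noncomputable section

/-- The Frobenius pushforward `F^e_* M`: the abelian group `M`, on which a ring `R` of
characteristic `p` acts through the `e`-th iterate of its Frobenius endomorphism. -/
def FrobPush (_p _e : ℕ) (M : Type*) : Type _ := M

namespace FrobPush

variable (p e d : ℕ) {R M N : Type*} [CommRing R] [ExpChar R p]
  [AddCommGroup M] [Module R M] [AddCommGroup N] [Module R N]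

instance (M : Type*) [AddCommGroup M] : AddCommGroup (FrobPush p e M) :=
  inferInstanceAs (AddCommGroup M)

instance : Module R (FrobPush p e M) :=
  Module.compHom M (iterateFrobenius R p e)

/-- The identity map `M → F^e_* M`, `m ↦ F^e_* m`. -/
def of (M : Type*) [AddCommGroup M] : M ≃+ FrobPush p e M := AddEquiv.refl M

theorem smul_of (r : R) (m : M) : r • of p e M m = of p e M (r ^ p ^ e • m) := rfl

theorem smul_eq (r : R) (x : FrobPush p e M) :
    r • x = of p e M (r ^ p ^ e • (of p e M).symm x) := rfl

variable {p d} in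
/-- The functor `F^e_*` on `R`-linear maps. -/
def map (ρ : M →ₗ[R] N) : FrobPush p e M →ₗ[R] FrobPush p e N where
  toFun x := of p e N (ρ ((of p e M).symm x))
  map_add' x y := by simp
  map_smul' r x := by simp [smul_eq]

variable {p e d} in
/-- The composition `φ ∘ F^d_* ϑ : F^{d+e}_* M → F^d_* R → R` of `φ : F^d_* R → R`
and `ϑ : F^e_* M → R`, where `F^d_* F^e_* M` is identified with `F^{d+e}_* M`. -/
def comp (φ : FrobPush p d R →ₗ[R] R) (ϑ : FrobPush p e M →ₗ[R] R) :
    FrobPush p (d + e) M →ₗ[R] R where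
  toFun x := φ (of p d R (ϑ (of p e M ((of p (d + e) M).symm x))))
  map_add' x y := by simp
  map_smul' r x := by
    have h : of p e M (r ^ p ^ (d + e) • (of p (d + e) M).symm x)
        = r ^ p ^ d • of p e M ((of p (d + e) M).symm x) := by
      rw [smul_of, ← pow_mul, ← pow_add]
    rw [smul_eq, AddEquiv.symm_apply_apply, h, map_smul, smul_eq_mul, ← smul_eq_mul,
      ← smul_of, map_smul, RingHom.id_apply]

end FrobPush

/-- A Cartier subalgebra `C = ⨁ C_e` of the full Cartier algebra `⨁ Hom_R(F^e_* R, R)`: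
a graded subring, closed under the left `R`-action, with `C_0 = R = Hom_R(R, R)`. (Closure
under the right action `φ ↦ φ(F^e_* r · -)` is multiplication by elements of `C_0`.) -/
structure CartierSubalgebra (R : Type*) [CommRing R] (p : ℕ) [ExpChar R p] where
  /-- The homogeneous component `C_e`. -/
  deg : (e : ℕ) → Submodule R (FrobPush p e R →ₗ[R] R)
  deg_zero : deg 0 = ⊤
  comp_mem : ∀ {d e : ℕ} {φ : FrobPush p d R →ₗ[R] R} {ψ : FrobPush p e R →ₗ[R] R},
    φ ∈ deg d → ψ ∈ deg e → FrobPush.comp φ ψ ∈ deg (d + e)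

/-- A graded left `C`-submodule of `M^♭ = ⨁ Hom_R(F^e_* M, R)`. -/
structure FlatSubmodule {R : Type*} [CommRing R] {p : ℕ} [ExpChar R p]
    (C : CartierSubalgebra R p) (M : Type*) [AddCommGroup M] [Module R M] where
  /-- The homogeneous component of degree `e`. -/
  deg : (e : ℕ) → Submodule R (FrobPush p e M →ₗ[R] R)
  comp_mem : ∀ {d e : ℕ} {φ : FrobPush p d R →ₗ[R] R} {ϑ : FrobPush p e M →ₗ[R] R},
    φ ∈ C.deg d → ϑ ∈ deg e → FrobPush.comp φ ϑ ∈ deg (d + e)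

section SplittingNumbers

variable (R : Type*) [CommRing R] [IsLocalRing R] (p : ℕ)

/-- The maps `F^e_* M → R` with image in the maximal ideal, `Hom_R(F^e_* M, 𝔪)`. -/
def nonsplit [ExpChar R p] (e : ℕ) (M : Type*) [AddCommGroup M] [Module R M] :
    Submodule R (FrobPush p e M →ₗ[R] R) where
  carrier := {ϑ | ∀ x, ϑ x ∈ IsLocalRing.maximalIdeal R}
  add_mem' ha hb x := add_mem (ha x) (hb x)
  zero_mem' _ := zero_mem _
  smul_mem' r _ h x := Ideal.mul_mem_left _ r (h x)

variable [Fact p.Prime] [CharP R p]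

instance residueFieldCharP : CharP (IsLocalRing.ResidueField R) p :=
  (CharP.charP_iff_prime_eq_zero (Fact.out : p.Prime)).2 (by
    rw [← map_natCast (IsLocalRing.residue R), CharP.cast_eq_zero, map_zero])

/-- `δ = dim R + log_p [k^{1/p} : k]`, where `k` is the residue field of `R` and
`[k^{1/p} : k]` is the dimension of `F_* k` over `k`. -/
def deltaExp : ℝ :=
  (((ringKrullDim R).unbotD 0).toNat : ℝ) +
    Real.logb p (Module.finrank (IsLocalRing.ResidueField R)
      (FrobPush p 1 (IsLocalRing.ResidueField R)))

end SplittingNumbers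

namespace FlatSubmodule

variable {R : Type*} [CommRing R] [IsLocalRing R] {p : ℕ} [Fact p.Prime] [CharP R p]
  {C : CartierSubalgebra R p} {M : Type*} [AddCommGroup M] [Module R M]

/-- The splitting number `a_e`: the length of `𝓜_e / 𝓜_e^{ns}`, where
`𝓜_e^{ns} = 𝓜_e ∩ Hom_R(F^e_* M, 𝔪)`. -/
def splittingNumber (𝓜 : FlatSubmodule C M) (e : ℕ) : ℕ∞ :=
  Module.length R (𝓜.deg e ⧸ (nonsplit R p e M).submoduleOf (𝓜.deg e))

/-- `n = gcd {e | a_e ≠ 0}`; it is `0` if and only if `a_e = 0` for all `e > 0`. -/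
def period (𝓜 : FlatSubmodule C M) : ℕ :=
  Nat.setGcd {e | 𝓜.splittingNumber e ≠ 0}

/-- The sequence `a_{e n} / q^δ`, `q = p^{e n}`. -/
def splittingSeq (𝓜 : FlatSubmodule C M) (e : ℕ) : ℝ :=
  ((𝓜.splittingNumber (e * 𝓜.period)).toNat : ℝ) /
    ((p : ℝ) ^ (e * 𝓜.period)) ^ deltaExp R p

/-- The limit that defines the splitting ratio exists (there is no limit to take if there
are no splittings in positive degrees). -/
def SplittingRatioExists (𝓜 : FlatSubmodule C M) : Prop :=
  𝓜.period ≠ 0 → ∃ r : ℝ, Tendsto 𝓜.splittingSeq atTop (𝓝 r)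

open Classical in
/-- The splitting ratio `asr(𝓜) = lim_e a_{e n} / q^δ`, which is `0` by convention if
`a_e = 0` for all `e > 0`. -/
def splittingRatio (𝓜 : FlatSubmodule C M) : ℝ :=
  if 𝓜.period = 0 then 0 else limUnder atTop 𝓜.splittingSeq

end FlatSubmodule

namespace CartierSubalgebra

variable {R : Type*} [CommRing R] {p : ℕ}

/-- `C` as a graded left module over itself, inside `R^♭ = ⨁ Hom_R(F^e_* R, R)`. -/
def self [ExpChar R p] (C : CartierSubalgebra R p) : FlatSubmodule C R where
  deg := C.deg
  comp_mem := C.comp_mem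

/-- The `F`-signature `s(R, C)`. -/
def fSignature [IsLocalRing R] [Fact p.Prime] [CharP R p] (C : CartierSubalgebra R p) : ℝ :=
  C.self.splittingRatio

/-- The graded module `M^♮`: in degree `e`, the additive subgroup of `Hom_R(F^e_* M, R)`
generated by all `φ ∘ F^e_* ρ` with `φ ∈ C_e` and `ρ ∈ Hom_R(M, R)`. -/
def natural [ExpChar R p] (C : CartierSubalgebra R p) (M : Type*) [AddCommGroup M]
    [Module R M] : FlatSubmodule C M where
  deg e :=
    { AddSubgroup.closure {ϑ : FrobPush p e M →ₗ[R] R |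
        ∃ φ ∈ C.deg e, ∃ ρ : M →ₗ[R] R, ϑ = φ ∘ₗ FrobPush.map e ρ} with
      smul_mem' := by
        intro r ϑ hϑ
        refine AddSubgroup.closure_induction (p := fun ϑ _ => r • ϑ ∈ AddSubgroup.closure _)
          ?_ ?_ ?_ ?_ hϑ
        · rintro _ ⟨φ, hφ, ρ, rfl⟩
          exact AddSubgroup.subset_closure ⟨r • φ, (C.deg e).smul_mem r hφ, ρ, rfl⟩
        · rw [smul_zero]; exact zero_mem _
        · intro x y _ _ hx hy
          rw [smul_add]; exact add_mem hx hy
        · intro x _ hx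
          rw [smul_neg]; exact neg_mem hx }
  comp_mem := by
    intro d e φ ϑ hφ hϑ
    refine AddSubgroup.closure_induction
      (p := fun ϑ _ => FrobPush.comp φ ϑ ∈ AddSubgroup.closure _) ?_ ?_ ?_ ?_ hϑ
    · rintro _ ⟨ψ, hψ, ρ, rfl⟩
      exact AddSubgroup.subset_closure ⟨FrobPush.comp φ ψ, C.comp_mem hφ hψ, ρ, rfl⟩
    · have : FrobPush.comp φ (0 : FrobPush p e M →ₗ[R] R) = 0 := by
        ext x; simp [FrobPush.comp]
      rw [this]; exact zero_mem _
    · intro x y _ _ hx hy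
      have : FrobPush.comp φ (x + y) = FrobPush.comp φ x + FrobPush.comp φ y := by
        ext z; simp [FrobPush.comp]
      rw [this]; exact add_mem hx hy
    · intro x _ hx
      have : FrobPush.comp φ (-x) = -FrobPush.comp φ x := by
        ext z; simp [FrobPush.comp]
      rw [this]; exact neg_mem hx

end CartierSubalgebra

end

/-! Write `q = p ^ e`, `d = dim R`, `κ = [k^{1/p} : k]`. Evaluation pairs `𝓜_e` with `F^e_* M` into
`k`; after dividing by both kernels the two sides have equal length. Hence `a_e(𝓜) = κ ^ e * length
(M / S_e)`, where `S_e` consists of the `m` that all of `𝓜_e` sends into `𝔪`. For `C` this is the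
ideal `I_e`, and for `M^♮` it is `{m | ρ m ∈ I_e for all ρ ∈ M^∨}`. The factor `κ ^ e` cancels in `q
^ δ`, which leaves lengths over `q ^ d`.

Rank: there are maps `g : R^r → M` and `h : M → R^r`, `r = rank M`, with both composites equal to
some `c ≠ 0`. They carry `I_e^r` into `S_e` and back, with cokernels killed by `c`. As `I_e ⊇
𝔪^{[q]}` and `c` lowers the dimension, the lengths of `M / S_e` and of `(R / I_e)^r` differ by `O(q
^ (d - 1))` (`exists_length_torsion_quotient_le`).

Existence of the limit: a nonzero `φ ∈ C_f` generates the dual of `F^f_* R` up to torsion and maps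
`F^f_* I_{e+f}` into `I_e`. The same comparison, with `rank F^f_* R ≥ κ ^ f * p ^ (f * d)`, shows
that `u_e = length (R / I_e) / q ^ d` satisfies `u_e ≤ u_{e+f} + K / p ^ e`. As `u` is bounded and
the degrees with a splitting form a semigroup, `u` converges along the multiples of their gcd.

The rank bound holds because otherwise the normalized lengths of `R / 𝔪^{[q]}` would contract to
zero, against the growth forced by a chain of primes. -/

noncomputable section

/-! ### Lengths of quotients -/

section Length

variable {R : Type*} [CommRing R]

/-- Length is subadditive along sequences that are exact in the middle. -/
theorem Module.length_le_add_of_exact {N M P : Type*} [AddCommGroup N] [AddCommGroup M]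
    [AddCommGroup P] [Module R N] [Module R M] [Module R P] (f : N →ₗ[R] M) (g : M →ₗ[R] P)
    (H : Function.Exact f g) :
    Module.length R M ≤ Module.length R N + Module.length R P := by
  rw [Module.length_eq_add_of_exact (LinearMap.range f).subtype g.rangeRestrict
    (Submodule.subtype_injective _) g.surjective_rangeRestrict
    (fun x => by
      rw [← LinearMap.mem_ker, LinearMap.ker_rangeRestrict, LinearMap.mem_ker, H x]
      simp)]
  exact add_le_add (Module.length_le_of_surjective f.rangeRestrict f.surjective_rangeRestrict)
    (Module.length_le_of_injective _ (Submodule.subtype_injective _))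

theorem Module.length_quotient_le_of_le {M : Type*} [AddCommGroup M] [Module R M]
    {A B : Submodule R M} (h : A ≤ B) : Module.length R (M ⧸ B) ≤ Module.length R (M ⧸ A) :=
  Module.length_le_of_surjective (Submodule.factor h) (Submodule.factor_surjective h)

/-- A map whose cokernel is controlled by an ideal compares lengths of quotients. -/
theorem Module.length_quotient_le_add {A B : Type*} [AddCommGroup A] [AddCommGroup B] [Module R A]
    [Module R B] (g : A →ₗ[R] B) {A' : Submodule R A} {B' : Submodule R B} (h : A' ≤ B'.comap g)
    {𝔞 : Ideal R} (h𝔞 : 𝔞 • (⊤ : Submodule R B) ≤ LinearMap.range g ⊔ B') :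
    Module.length R (B ⧸ B') ≤
      Module.length R (A ⧸ A') + Module.length R (B ⧸ 𝔞 • (⊤ : Submodule R B)) := by
  refine (Module.length_le_add_of_exact (Submodule.mapQ A' B' g h)
    (Submodule.factor (le_sup_right : B' ≤ LinearMap.range g ⊔ B')) ?_).trans
    (add_le_add le_rfl (Module.length_quotient_le_of_le h𝔞))
  intro x
  obtain ⟨b, rfl⟩ := Submodule.mkQ_surjective _ x
  constructor
  · intro hb
    have hb' : b ∈ LinearMap.range g ⊔ B' := (Submodule.Quotient.mk_eq_zero _).1 hb
    obtain ⟨_, ⟨a, rfl⟩, b', hbB, rfl⟩ := Submodule.mem_sup.1 hb'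
    refine ⟨A'.mkQ a, (Submodule.Quotient.eq _).2 ?_⟩
    simpa using hbB
  · rintro ⟨a, ha⟩
    obtain ⟨a, rfl⟩ := Submodule.mkQ_surjective _ a
    rw [← ha]
    exact (Submodule.Quotient.mk_eq_zero _).2 (Submodule.mem_sup_left ⟨a, rfl⟩)

theorem Module.length_pi_quotient (r : ℕ) (I : Ideal R) :
    Module.length R ((Fin r → R) ⧸ Submodule.pi Set.univ (fun _ : Fin r => I)) =
      r * Module.length R (R ⧸ I) := by
  rw [(Submodule.quotientPi (fun _ : Fin r => (I : Submodule R R))).length_eq]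
  simp

/-- A quotient of a module with `r` generators has length at most `r` times that of the ring. -/
theorem Module.exists_length_quotient_smul_le (M : Type*) [AddCommGroup M] [Module R M]
    [Module.Finite R M] : ∃ r : ℕ, ∀ 𝔞 : Ideal R,
      Module.length R (M ⧸ 𝔞 • (⊤ : Submodule R M)) ≤ r * Module.length R (R ⧸ 𝔞) := by
  obtain ⟨r, f, hf⟩ := Module.Finite.exists_fin' R M
  refine ⟨r, fun 𝔞 => ?_⟩
  rw [← Module.length_pi_quotient]
  have h : Submodule.pi Set.univ (fun _ : Fin r => (𝔞 : Submodule R R)) ≤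
      (𝔞 • (⊤ : Submodule R M)).comap f := by
    intro v hv
    rw [Submodule.mem_comap, pi_eq_sum_univ v, map_sum]
    refine Submodule.sum_mem _ fun i _ => ?_
    rw [map_smul]
    exact Submodule.smul_mem_smul (hv i trivial) trivial
  refine Module.length_le_of_surjective (Submodule.mapQ _ _ f h) ?_
  intro x
  obtain ⟨b, rfl⟩ := Submodule.mkQ_surjective _ x
  obtain ⟨a, rfl⟩ := hf b
  exact ⟨Submodule.mkQ _ a, rfl⟩

/-- Each step of the filtration by powers of `x` is a quotient of `R / (I + (x))`, through
multiplication by `x ^ q`. -/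
theorem Ideal.length_quotient_sup_pow_le (I : Ideal R) (x : R) (q : ℕ) :
    Module.length R (R ⧸ (I ⊔ Ideal.span {x ^ q})) ≤
      q * Module.length R (R ⧸ (I ⊔ Ideal.span {x})) := by
  induction q with
  | zero =>
    rw [Nat.cast_zero, zero_mul, nonpos_iff_eq_zero, Module.length_eq_zero_iff]
    simp
  | succ q ih =>
    have hle : I ⊔ Ideal.span {x ^ (q + 1)} ≤ I ⊔ Ideal.span {x ^ q} :=
      sup_le_sup_left (Ideal.span_singleton_le_span_singleton.2 (pow_dvd_pow x q.le_succ)) _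
    have hmul : I ⊔ Ideal.span {x} ≤
        Submodule.comap (LinearMap.mulLeft R (x ^ q)) (I ⊔ Ideal.span {x ^ (q + 1)}) := by
      refine sup_le (fun y hy => ?_) ?_
      · exact Ideal.mul_mem_left _ _ (Ideal.mem_sup_left hy)
      · rw [Ideal.span_le, Set.singleton_subset_iff]
        change x ^ q * x ∈ I ⊔ Ideal.span {x ^ (q + 1)}
        rw [← pow_succ]
        exact Ideal.mem_sup_right (Ideal.mem_span_singleton_self _)
    have := Module.length_le_add_of_exact (Submodule.mapQ _ _ _ hmul) (Submodule.factor hle) ?_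
    · refine this.trans ((add_le_add le_rfl ih).trans ?_)
      push_cast
      rw [add_mul, one_mul, add_comm]
    · intro y
      obtain ⟨y, rfl⟩ := Submodule.mkQ_surjective _ y
      constructor
      · intro hy
        have hy' : y ∈ I ⊔ Ideal.span {x ^ q} := (Submodule.Quotient.mk_eq_zero _).1 hy
        obtain ⟨a, ha, b, hb, rfl⟩ := Submodule.mem_sup.1 hy'
        obtain ⟨z, rfl⟩ := Ideal.mem_span_singleton'.1 hb
        refine ⟨Submodule.mkQ _ z, ?_⟩
        rw [Submodule.mkQ_apply, Submodule.mapQ_apply, Submodule.mkQ_apply,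
          Submodule.Quotient.eq]
        have : LinearMap.mulLeft R (x ^ q) z - (a + z * x ^ q) = -a := by
          simp only [LinearMap.mulLeft_apply]; ring
        rw [this]
        exact neg_mem (Ideal.mem_sup_left ha)
      · rintro ⟨a, ha⟩
        obtain ⟨a, rfl⟩ := Submodule.mkQ_surjective _ a
        rw [← ha]
        exact (Submodule.Quotient.mk_eq_zero _).2
          (Ideal.mem_sup_right (Ideal.mul_mem_right _ _ (Ideal.mem_span_singleton_self _)))

/-- The generators are raised to powers one at a time while the others are absorbed into `I`, hence
the generality in `I`. -/
theorem Ideal.length_quotient_sup_span_pow_le (s : Finset R) (q : ℕ) (I : Ideal R) :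
    Module.length R (R ⧸ (I ⊔ Ideal.span (Set.image (fun x => x ^ q) (s : Set R)))) ≤
      (q : ℕ∞) ^ s.card * Module.length R (R ⧸ (I ⊔ Ideal.span (s : Set R))) := by
  classical
  induction s using Finset.induction_on generalizing I with
  | empty => rw [Finset.coe_empty, Set.image_empty]; simp
  | insert x s hx ih =>
    rw [Finset.coe_insert, Set.image_insert_eq, Ideal.span_insert, Ideal.span_insert,
      ← sup_assoc, Finset.card_insert_of_notMem hx, pow_succ, mul_assoc]
    refine (ih _).trans (mul_le_mul_right ?_ _)
    rw [sup_right_comm, ← sup_assoc, sup_right_comm _ (Ideal.span {x})]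
    exact Ideal.length_quotient_sup_pow_le _ _ _

end Length

/-! ### Duality with the residue field -/

section Pairing

variable {R : Type*} [CommRing R] [IsLocalRing R]

open IsLocalRing

theorem IsLocalRing.length_residueField : Module.length R (ResidueField R) = 1 := by
  rw [Module.length_eq_of_surjective (R := ResidueField R) IsLocalRing.residue_surjective,
    Module.length_eq_one]

/-- `Hom(-, k)` is left exact, and a map from a simple module to `k` is determined by its value at
one nonzero vector. -/
theorem IsLocalRing.length_hom_residueField_le (Y : Type*) [AddCommGroup Y] [Module R Y] :
    Module.length R (Y →ₗ[R] ResidueField R) ≤ Module.length R Y := by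
  by_cases hY : Module.length R Y = ⊤
  · rw [hY]; exact le_top
  rw [← ne_eq, Module.length_ne_top_iff] at hY
  induction hY with
  | of_subsingleton =>
    rw [Module.length_eq_zero]; exact zero_le
  | @of_simple_quotient M _ _ N _ _ ih =>
    have h1 : Module.length R ((M ⧸ N) →ₗ[R] ResidueField R) ≤ Module.length R (M ⧸ N) := by
      have := IsSimpleModule.nontrivial R (M ⧸ N)
      obtain ⟨y, hy⟩ := exists_ne (0 : M ⧸ N)
      rw [Module.length_eq_one R (M ⧸ N), ← IsLocalRing.length_residueField (R := R)]
      refine Module.length_le_of_injective (LinearMap.applyₗ y) ?_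
      rw [← LinearMap.ker_eq_bot, LinearMap.ker_eq_bot']
      intro f hf
      have : Submodule.span R {y} ≤ LinearMap.ker f := by
        rw [Submodule.span_singleton_le_iff_mem]; exact hf
      rw [IsSimpleModule.span_singleton_eq_top R hy, top_le_iff, LinearMap.ker_eq_top] at this
      exact this
    rw [Module.length_eq_add_of_exact N.subtype N.mkQ N.subtype_injective N.mkQ_surjective
      (LinearMap.exact_subtype_mkQ N), add_comm]
    refine (Module.length_le_add_of_exact (LinearMap.lcomp R (ResidueField R) N.mkQ)
      (LinearMap.lcomp R (ResidueField R) N.subtype) ?_).trans (add_le_add h1 ih)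
    intro f
    constructor
    · intro hf
      refine ⟨N.liftQ f fun x hx => ?_, ?_⟩
      · exact LinearMap.congr_fun hf ⟨x, hx⟩
      · ext x; rfl
    · rintro ⟨g, rfl⟩
      ext x
      change g (Submodule.Quotient.mk x.1) = 0
      rw [(Submodule.Quotient.mk_eq_zero N).2 x.2, map_zero]

/-- The vectors on which all functionals in `W` take values in the maximal ideal. -/
def maximalOrthogonal {X : Type*} [AddCommGroup X] [Module R X]
    (W : Submodule R (X →ₗ[R] R)) : Submodule R X where
  carrier := {x | ∀ w ∈ W, w x ∈ maximalIdeal R}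
  add_mem' ha hb w hw := by rw [map_add]; exact add_mem (ha w hw) (hb w hw)
  zero_mem' w _ := by rw [map_zero]; exact zero_mem _
  smul_mem' r _ h w hw := by rw [map_smul]; exact Ideal.mul_mem_left _ r (h w hw)

/-- The functionals with values in the maximal ideal and the vectors paired into the maximal
ideal have quotients of the same length: the induced pairing to the residue field is perfect. -/
theorem length_quotient_eq_length_quotient_maximalOrthogonal {X : Type*} [AddCommGroup X]
    [Module R X] (W ns : Submodule R (X →ₗ[R] R))
    (hns : ∀ w, w ∈ ns ↔ ∀ x, w x ∈ maximalIdeal R) :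
    Module.length R (W ⧸ ns.submoduleOf W) = Module.length R (X ⧸ maximalOrthogonal W) := by
  let B : W →ₗ[R] X →ₗ[R] ResidueField R :=
    (LinearMap.llcomp R X R (ResidueField R) (Algebra.linearMap R (ResidueField R))) ∘ₗ W.subtype
  have hB : ∀ (w : W) (x : X), B w x = 0 ↔ w.1 x ∈ maximalIdeal R := fun w x => by
    rw [← IsLocalRing.residue_eq_zero_iff]; rfl
  have hL : LinearMap.ker B = ns.submoduleOf W := by
    ext w
    rw [LinearMap.mem_ker, LinearMap.ext_iff]
    exact (forall_congr' fun x => hB w x).trans (hns w.1).symm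
  have hR : LinearMap.ker B.flip = maximalOrthogonal W := by
    ext x
    rw [LinearMap.mem_ker, LinearMap.ext_iff]
    exact ⟨fun h w hw => (hB ⟨w, hw⟩ x).1 (h ⟨w, hw⟩), fun h w => (hB w x).2 (h w.1 w.2)⟩
  rw [← hL, ← hR]
  -- Each quotient embeds in the `k`-valued dual of the other.
  apply le_antisymm
  · refine le_trans ?_ (IsLocalRing.length_hom_residueField_le _)
    let B' : W →ₗ[R] (X ⧸ LinearMap.ker B.flip) →ₗ[R] ResidueField R :=
      LinearMap.flip ((LinearMap.ker B.flip).liftQ B.flip le_rfl)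
    have : LinearMap.ker B ≤ LinearMap.ker B' := fun w hw => by
      ext x
      exact LinearMap.congr_fun hw x
    refine Module.length_le_of_injective ((LinearMap.ker B).liftQ B' this) ?_
    rw [← LinearMap.ker_eq_bot]
    refine Submodule.ker_liftQ_eq_bot _ _ _ fun w hw => ?_
    ext x
    exact LinearMap.congr_fun hw (Submodule.Quotient.mk x)
  · refine le_trans ?_ (IsLocalRing.length_hom_residueField_le _)
    let B' : X →ₗ[R] (W ⧸ LinearMap.ker B) →ₗ[R] ResidueField R :=
      LinearMap.flip ((LinearMap.ker B).liftQ B le_rfl)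
    have : LinearMap.ker B.flip ≤ LinearMap.ker B' := fun w hw => by
      ext x
      exact LinearMap.congr_fun hw x
    refine Module.length_le_of_injective ((LinearMap.ker B.flip).liftQ B' this) ?_
    rw [← LinearMap.ker_eq_bot]
    refine Submodule.ker_liftQ_eq_bot _ _ _ fun w hw => ?_
    ext x
    exact LinearMap.congr_fun hw (Submodule.Quotient.mk x)

end Pairing

/-! ### Lower bounds for length from chains of primes -/

section Growth

variable {R : Type*} [CommRing R] [IsNoetherianRing R]

/-- The Artin-Rees lemma for the colon ideals of an element outside a prime. -/
theorem Ideal.exists_mem_sup_pow_of_mul_mem (𝔪 P : Ideal R) [P.IsPrime] {x : R} (hx : x ∉ P) :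
    ∃ c : ℕ, ∀ n y, x * y ∈ P ⊔ 𝔪 ^ (n + c) → y ∈ P ⊔ 𝔪 ^ n := by
  obtain ⟨c, hc⟩ := Ideal.exists_pow_inf_eq_pow_smul 𝔪
    (Submodule.span R {(Submodule.Quotient.mk x : R ⧸ P)})
  refine ⟨c, fun n y hxy => ?_⟩
  obtain ⟨a, ha, b, hb, hab⟩ := Submodule.mem_sup.1 hxy
  have h1 : (Submodule.Quotient.mk (x * y) : R ⧸ P) ∈ 𝔪 ^ (n + c) • (⊤ : Submodule R (R ⧸ P)) ⊓
      Submodule.span R {(Submodule.Quotient.mk x : R ⧸ P)} := by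
    refine ⟨?_, ?_⟩
    · have : (Submodule.Quotient.mk (x * y) : R ⧸ P) = b • Submodule.Quotient.mk 1 := by
        rw [← Submodule.Quotient.mk_smul, Submodule.Quotient.eq, ← hab]
        simpa using ha
      rw [this]
      exact Submodule.smul_mem_smul hb trivial
    · exact Submodule.mem_span_singleton.2 ⟨y, by
        rw [← Submodule.Quotient.mk_smul, smul_eq_mul, mul_comm]⟩
  rw [hc _ (Nat.le_add_left _ _), Nat.add_sub_cancel] at h1
  obtain ⟨z, hz, hzx⟩ := Submodule.mem_smul_span_singleton.1
    (Submodule.smul_mono le_rfl inf_le_right h1)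
  rw [← Submodule.Quotient.mk_smul, Submodule.Quotient.eq] at hzx
  have h2 : x * (y - z) ∈ P := by
    rw [← neg_mem_iff]
    convert hzx using 1
    simp only [smul_eq_mul]; ring
  have h3 := (Ideal.IsPrime.mem_or_mem ‹_› h2).resolve_left hx
  rw [← sub_add_cancel y z]
  exact add_mem (Ideal.mem_sup_left h3) (Ideal.mem_sup_right hz)

/-- For `x ∈ Q \ P`, multiplication by `x` into `R / (P + 𝔪 ^ (n + c))` has kernel inside `P + 𝔪 ^
n` by Artin-Rees, and its cokernel surjects onto `R / (Q + 𝔪 ^ (n + c))`. -/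
theorem Ideal.exists_length_add_length_le (𝔪 P Q : Ideal R) [P.IsPrime] (h : P < Q) :
    ∃ c : ℕ, ∀ n, Module.length R (R ⧸ (P ⊔ 𝔪 ^ n)) + Module.length R (R ⧸ (Q ⊔ 𝔪 ^ (n + c))) ≤
      Module.length R (R ⧸ (P ⊔ 𝔪 ^ (n + c))) := by
  obtain ⟨hPQ, x, hxQ, hxP⟩ := SetLike.lt_iff_le_and_exists.1 h
  obtain ⟨c, hc⟩ := Ideal.exists_mem_sup_pow_of_mul_mem 𝔪 P hxP
  refine ⟨c, fun n => ?_⟩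
  let f : R →ₗ[R] R ⧸ (P ⊔ 𝔪 ^ (n + c)) :=
    Submodule.mkQ _ ∘ₗ LinearMap.mulLeft R x
  rw [Module.length_eq_add_of_exact (LinearMap.range f).subtype (LinearMap.range f).mkQ
    (Submodule.subtype_injective _) (Submodule.mkQ_surjective _) (LinearMap.exact_subtype_mkQ _),
    ← f.quotKerEquivRange.length_eq]
  refine add_le_add (Module.length_quotient_le_of_le fun y hy => ?_) ?_
  · exact hc n y ((Submodule.Quotient.mk_eq_zero _).1 hy)
  · let g := Submodule.factor (sup_le_sup_right hPQ (𝔪 ^ (n + c)))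
    have hg : LinearMap.range f ≤ LinearMap.ker g := by
      rintro _ ⟨y, rfl⟩
      exact (Submodule.Quotient.mk_eq_zero _).2 (Ideal.mem_sup_left (Ideal.mul_mem_right _ _ hxQ))
    refine Module.length_le_of_surjective ((LinearMap.range f).liftQ g hg) ?_
    rw [← LinearMap.range_eq_top, Submodule.range_liftQ, LinearMap.range_eq_top]
    exact Submodule.factor_surjective _

/-- A chain of `d + 1` primes forces the length of `R / (P + 𝔪 ^ n)` to grow with order `d`. -/
theorem exists_pow_le_length_quotient_sup_pow [IsLocalRing R] (d : ℕ)
    (s : LTSeries (PrimeSpectrum R)) (hs : s.length = d) : ∃ b : ℕ, ∀ n : ℕ, 1 ≤ n → (n : ℕ∞) ^ d ≤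
      Module.length R (R ⧸ (s.head.asIdeal ⊔ IsLocalRing.maximalIdeal R ^ (b * n))) := by
  induction d generalizing s with
  | zero =>
    refine ⟨1, fun n hn => ?_⟩
    rw [pow_zero, Order.one_le_iff_pos, Module.length_pos_iff]
    rw [Submodule.Quotient.nontrivial_iff]
    refine ne_top_of_le_ne_top (IsLocalRing.maximalIdeal.isMaximal R).ne_top (sup_le ?_ ?_)
    · exact IsLocalRing.le_maximalIdeal s.head.2.ne_top
    · exact Ideal.pow_le_self (by omega)
  | succ d ih =>
    have hne : s.length ≠ 0 := by omega
    obtain ⟨b, hb⟩ := ih (s.tail hne) (by simp [hs])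
    rw [RelSeries.head_tail] at hb
    have hlt : s.head.asIdeal < (s 1).asIdeal := by
      have := s.rel_of_lt (i := 0) (j := 1) (by
        rw [Fin.lt_def]
        simp [Nat.mod_eq_of_lt, hs])
      exact this
    obtain ⟨c, hc⟩ := Ideal.exists_length_add_length_le (IsLocalRing.maximalIdeal R)
      s.head.asIdeal (s 1).asIdeal hlt
    refine ⟨b + c, fun n hn => ?_⟩
    -- Each increase of the exponent by `c` gains a term of order `n ^ d` from the next prime; `n`
    -- such increases give `n ^ (d + 1)`.
    have key : ∀ j : ℕ, j * (n : ℕ∞) ^ d ≤ Module.length R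
        (R ⧸ (s.head.asIdeal ⊔ IsLocalRing.maximalIdeal R ^ (b * n + j * c))) := by
      intro j
      induction j with
      | zero => simp
      | succ j ihj =>
        rw [add_mul j 1 c, one_mul, ← add_assoc]
        refine le_trans ?_ (hc _)
        push_cast
        rw [add_mul, one_mul]
        refine add_le_add ihj ((hb n hn).trans (Module.length_quotient_le_of_le ?_))
        exact sup_le_sup_left
          (Ideal.pow_le_pow_right (by rw [add_assoc]; exact Nat.le_add_right _ _)) _
    rw [pow_succ, mul_comm, add_mul, mul_comm c n]
    exact key n

end Growth

/-! ### Systems of parameters -/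

section Parameters

variable {R : Type*} [CommRing R] [IsNoetherianRing R] [IsLocalRing R]

variable (R) in
/-- The Krull dimension of a noetherian local ring as a natural number. -/
abbrev localDim : ℕ := ((ringKrullDim R).unbotD 0).toNat

theorem coe_localDim : (localDim R : WithBot ℕ∞) = ringKrullDim R := by
  rw [localDim, ← IsLocalRing.maximalIdeal_height_eq_ringKrullDim]
  have := Ideal.height_ne_top (IsLocalRing.maximalIdeal.isMaximal R).ne_top
  rw [WithBot.unbotD_coe]
  conv_rhs => rw [← ENat.natCast_toNat this]
  rfl

theorem IsLocalRing.length_quotient_ne_top {I : Ideal R}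
    (hI : IsLocalRing.maximalIdeal R ∈ I.minimalPrimes) : Module.length R (R ⧸ I) ≠ ⊤ := by
  have := IsLocalRing.quotient_artinian_of_mem_minimalPrimes_of_isLocalRing I hI
  rw [Module.length_eq_of_surjective (R := R ⧸ I) Ideal.Quotient.mk_surjective]
  exact Module.length_ne_top

variable (R) in
theorem exists_parameters : ∃ s : Finset R, s.card = localDim R ∧
    (s : Set R) ⊆ IsLocalRing.maximalIdeal R ∧
    Module.length R (R ⧸ Ideal.span (s : Set R)) ≠ ⊤ := by
  obtain ⟨s, hs, hcard⟩ :=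
    Ideal.exists_finset_card_eq_height_of_isNoetherianRing (IsLocalRing.maximalIdeal R)
  refine ⟨s, ?_, Ideal.span_le.1 hs.1.2, IsLocalRing.length_quotient_ne_top hs⟩
  have := coe_localDim (R := R)
  rw [← IsLocalRing.maximalIdeal_height_eq_ringKrullDim, ← hcard] at this
  exact_mod_cast this.symm

/-- Lifting parameters of `R / (c)`: its dimension is smaller because `c` is a nonzerodivisor. The
missing parameter is the source of the saved factor `q` in all error terms. -/
theorem exists_parameters_quotient [IsDomain R] {c : R} (hc : c ∈ IsLocalRing.maximalIdeal R)
    (hc0 : c ≠ 0) : ∃ s : Finset R, s.card + 1 ≤ localDim R ∧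
    (s : Set R) ⊆ IsLocalRing.maximalIdeal R ∧
    Module.length R (R ⧸ (Ideal.span {c} ⊔ Ideal.span (s : Set R))) ≠ ⊤ := by
  classical
  have : Nontrivial (R ⧸ Ideal.span {c}) := Ideal.Quotient.nontrivial_iff.2
    (ne_top_of_le_ne_top (IsLocalRing.maximalIdeal.isMaximal R).ne_top
      ((Ideal.span_singleton_le_iff_mem _).2 hc))
  have : IsLocalRing (R ⧸ Ideal.span {c}) :=
    IsLocalRing.of_surjective' (Ideal.Quotient.mk _) Ideal.Quotient.mk_surjective
  obtain ⟨t, ht, hcard⟩ := Ideal.exists_finset_card_eq_height_of_isNoetherianRing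
    (IsLocalRing.maximalIdeal (R ⧸ Ideal.span {c}))
  let f := Ideal.Quotient.mk (Ideal.span {c})
  have hf : Function.Surjective f := Ideal.Quotient.mk_surjective
  let s : Finset R := t.image (Function.surjInv hf)
  have hfs : Set.image f (s : Set R) = t := by
    rw [Finset.coe_image, ← Set.image_comp]
    simp [Function.surjInv_eq]
  have hcomap : (Ideal.span (t : Set _)).comap f = Ideal.span {c} ⊔ Ideal.span (s : Set R) := by
    rw [← hfs, ← Ideal.map_span, Ideal.comap_map_of_surjective f hf, ← RingHom.ker_eq_comap_bot,
      Ideal.mk_ker, sup_comm]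
  have hmin : IsLocalRing.maximalIdeal R ∈
      (Ideal.span {c} ⊔ Ideal.span (s : Set R)).minimalPrimes := by
    rw [← hcomap, Ideal.comap_minimalPrimes_eq_of_surjective hf]
    exact ⟨_, ht, IsLocalRing.eq_maximalIdeal
      (Ideal.comap_isMaximal_of_surjective f hf)⟩
  refine ⟨s, ?_, Ideal.span_le.1 (le_sup_right.trans hmin.1.2),
    IsLocalRing.length_quotient_ne_top hmin⟩
  have h1 := ringKrullDim_quotient_succ_le_of_nonZeroDivisor (mem_nonZeroDivisors_of_ne_zero hc0)
  rw [← coe_localDim (R := R), ← IsLocalRing.maximalIdeal_height_eq_ringKrullDim, ← hcard] at h1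
  have h2 : t.card + 1 ≤ localDim R := by exact_mod_cast h1
  exact (Nat.add_le_add_right Finset.card_image_le 1).trans h2

end Parameters

/-! ### Finite modules are free up to torsion -/

section Frame

variable {R : Type*} [CommRing R] [IsDomain R]

/-- A finite module over a domain is isomorphic to a free module up to a nonzero scalar. -/
theorem Module.exists_quasi_inverse (M : Type*) [AddCommGroup M] [Module R M] [Module.Finite R M] :
    ∃ c : R, c ≠ 0 ∧ ∃ (g : (Fin (Module.finrank R M) → R) →ₗ[R] M)
      (h : M →ₗ[R] (Fin (Module.finrank R M) → R)),
      (∀ m, g (h m) = c • m) ∧ ∀ v, h (g v) = c • v := by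
  obtain ⟨f, hf⟩ := exists_linearIndependent_of_le_finrank (R := R) (M := M) le_rfl
  let g := Fintype.linearCombination R f
  have hg : Function.Injective g :=
    linearIndependent_iff_injective_fintypeLinearCombination.1 hf
  have hr : LinearMap.range g = Submodule.span R (Set.range f) :=
    Fintype.range_linearCombination R f
  have h0 : Module.finrank R (M ⧸ LinearMap.range g) = 0 := by
    have := Submodule.finrank_quotient_add_finrank (LinearMap.range g)
    have h2 := finrank_span_eq_card hf
    rw [← hr, Fintype.card_fin] at h2
    omega
  -- A finite module of rank zero is torsion, and a single nonzero `c` annihilates it.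
  obtain ⟨c, hc, hc'⟩ := Submodule.annihilator_top_inter_nonZeroDivisors
    (Module.finrank_eq_zero_iff_isTorsion.1 h0)
  have hcm : ∀ m, c • m ∈ LinearMap.range g := fun m => by
    have := Submodule.mem_annihilator.1 hc (Submodule.Quotient.mk m) trivial
    rwa [← Submodule.Quotient.mk_smul, Submodule.Quotient.mk_eq_zero] at this
  let e := LinearEquiv.ofInjective g hg
  let h : M →ₗ[R] (Fin (Module.finrank R M) → R) :=
    e.symm.toLinearMap ∘ₗ (LinearMap.lsmul R M c).codRestrict (LinearMap.range g) hcm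
  have hgh : ∀ m, g (h m) = c • m := fun m => by
    change (e (e.symm _) : M) = c • m
    rw [e.apply_symm_apply]; rfl
  refine ⟨c, nonZeroDivisors.ne_zero hc', g, h, hgh, fun v => hg ?_⟩
  rw [hgh, map_smul]

end Frame

/-! ### Frobenius pushforward: finiteness and length -/

namespace FrobPush

section

variable {p : ℕ} (e d : ℕ) {R M N : Type*} [CommRing R] [ExpChar R p]
  [AddCommGroup M] [Module R M] [AddCommGroup N] [Module R N]

/-- The submodule `F^e_* N` of `F^e_* M`. -/
def submodule (S : Submodule R M) : Submodule R (FrobPush p e M) where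
  carrier := {x | (of p e M).symm x ∈ S}
  add_mem' ha hb := by
    simp only [Set.mem_ofPred_eq, map_add] at *
    exact add_mem ha hb
  zero_mem' := by simp
  smul_mem' r x hx := by
    simp only [Set.mem_ofPred_eq, smul_eq, AddEquiv.symm_apply_apply] at *
    exact S.smul_mem _ hx

theorem mem_submodule {S : Submodule R M} {m : M} : of p e M m ∈ submodule e S ↔ m ∈ S := Iff.rfl

/-- `F^e_* M / F^e_* N = F^e_* (M / N)`. -/
def quotientEquiv (S : Submodule R M) :
    (FrobPush p e M ⧸ submodule (p := p) e S) ≃ₗ[R] FrobPush p e (M ⧸ S) :=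
  Submodule.quotEquivOfEq _ _ (by
    ext x
    change _ ↔ Submodule.Quotient.mk ((of p e M).symm x) = (0 : M ⧸ S)
    rw [Submodule.Quotient.mk_eq_zero]; rfl) ≪≫ₗ
  (map (p := p) e S.mkQ).quotKerEquivOfSurjective (fun x => by
    obtain ⟨m, hm⟩ := S.mkQ_surjective ((of p e _).symm x)
    exact ⟨of p e M m, hm⟩)

/-- `F^0_* M = M`. -/
def zeroEquiv : FrobPush p 0 M ≃ₗ[R] M where
  __ := (of p 0 M).symm
  map_smul' r x := by
    change (of p 0 M).symm (r • x) = r • (of p 0 M).symm x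
    rw [smul_eq, AddEquiv.symm_apply_apply, pow_zero, pow_one]

/-- `F^d_* F^e_* M = F^{d+e}_* M`. -/
def addEquiv : FrobPush p d (FrobPush p e M) ≃ₗ[R] FrobPush p (d + e) M where
  toFun x := of p (d + e) M ((of p e M).symm ((of p d _).symm x))
  invFun x := of p d _ (of p e M ((of p (d + e) M).symm x))
  left_inv _ := rfl
  right_inv _ := rfl
  map_add' _ _ := rfl
  map_smul' r x := by
    simp only [smul_eq, AddEquiv.symm_apply_apply, RingHom.id_apply]
    rw [← pow_mul, ← pow_add]

/-- The functor `F^e_*` on isomorphisms. -/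
def congr (f : M ≃ₗ[R] N) : FrobPush p e M ≃ₗ[R] FrobPush p e N :=
  LinearEquiv.ofBijective (map (p := p) e f.toLinearMap) f.bijective

theorem finite_one_self (hF : (frobenius R p).Finite) : Module.Finite R (FrobPush p 1 R) := by
  classical
  let A : Algebra R R := (frobenius R p).toAlgebra
  have hfin : @Module.Finite R R _ _ A.toModule := hF
  obtain ⟨s, hs⟩ := hfin.fg_top
  refine ⟨⟨s.image (of p 1 R), ?_⟩⟩
  rw [eq_top_iff]
  intro x _
  have hx : (of p 1 R).symm x ∈ @Submodule.span R R _ _ A.toModule s := by rw [hs]; trivial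
  refine @Submodule.span_induction R R _ _ A.toModule s
    (fun y _ => of p 1 R y ∈ Submodule.span R (s.image (of p 1 R) : Set (FrobPush p 1 R)))
    ?_ ?_ ?_ ?_ _ hx
  · intro y hy
    exact Submodule.subset_span (Finset.mem_coe.2 (Finset.mem_image_of_mem _ hy))
  · rw [map_zero]; exact zero_mem _
  · intro y z _ _ hy hz
    rw [map_add]; exact add_mem hy hz
  · intro r y _ hy
    convert Submodule.smul_mem _ r hy using 1
    rw [smul_of, pow_one]
    rfl

theorem finite_one (hF : (frobenius R p).Finite) [Module.Finite R M] :
    Module.Finite R (FrobPush p 1 M) := by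
  obtain ⟨r, f, hf⟩ := Module.Finite.exists_fin' R M
  have := finite_one_self hF
  let g : Fin r → FrobPush p 1 R →ₗ[R] FrobPush p 1 M := fun i =>
    map (p := p) 1 (LinearMap.toSpanSingleton R M (f (Pi.single i 1)))
  refine Module.Finite.of_surjective (LinearMap.lsum R (fun _ => FrobPush p 1 R) R g) fun x => ?_
  obtain ⟨v, hv⟩ := hf ((of p 1 M).symm x)
  refine ⟨fun i => of p 1 R (v i), ?_⟩
  rw [LinearMap.lsum_apply, LinearMap.sum_apply]
  apply (of p 1 M).symm.injective
  have hfv : f v = ∑ i, v i • f (Pi.single i 1) := by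
    conv_lhs => rw [pi_eq_sum_univ' v, map_sum]
    exact Finset.sum_congr rfl fun i _ => map_smul _ _ _
  rw [← hv, hfv, map_sum]
  exact Finset.sum_congr rfl fun i _ => rfl

theorem finite (hF : (frobenius R p).Finite) [Module.Finite R M] :
    Module.Finite R (FrobPush p e M) := by
  induction e with
  | zero =>
    refine Module.Finite.equiv (M := M) (LinearEquiv.symm (?_ : FrobPush p 0 M ≃ₗ[R] M))
    exact zeroEquiv
  | succ e ih =>
    rw [add_comm]
    have := finite_one (p := p) (M := FrobPush p e M) hF
    exact Module.Finite.equiv (addEquiv e 1)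

end

section

variable {R : Type*} [CommRing R] [IsLocalRing R] {p : ℕ} [Fact p.Prime] [CharP R p]

open IsLocalRing

variable (R p) in
/-- The degree `[k^{1/p} : k]` of the residue field. -/
def residueDegree : ℕ :=
  Module.finrank (ResidueField R) (FrobPush p 1 (ResidueField R))

theorem length_one_residueField (hF : (frobenius R p).Finite) :
    Module.length R (FrobPush p 1 (ResidueField R)) = residueDegree R p := by
  have : IsScalarTower R (ResidueField R) (FrobPush p 1 (ResidueField R)) := by
    refine .of_algebraMap_smul fun r x => ?_
    rw [smul_eq, smul_eq, ← map_pow, algebraMap_smul]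
  have := finite (p := p) 1 (M := ResidueField R) hF
  have : Module.Finite (ResidueField R) (FrobPush p 1 (ResidueField R)) :=
    Module.Finite.of_restrictScalars_finite R _ _
  rw [Module.length_eq_of_surjective (R := ResidueField R) residue_surjective,
    Module.length_eq_finrank, residueDegree]

theorem residueDegree_pos (hF : (frobenius R p).Finite) : 0 < residueDegree R p := by
  have := length_one_residueField (p := p) hF
  have h : 0 < Module.length R (FrobPush p 1 (ResidueField R)) :=
    Module.length_pos_iff.2 (inferInstanceAs (Nontrivial (ResidueField R)))
  rw [this] at h
  exact_mod_cast h

/-- `F_*` is exact, so along a composition series every simple factor `k` contributes the length of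
`F_* k`. -/
theorem length_one (hF : (frobenius R p).Finite) {N : Type*} [AddCommGroup N] [Module R N]
    (hN : IsFiniteLength R N) :
    Module.length R (FrobPush p 1 N) = residueDegree R p * Module.length R N := by
  induction hN with
  | @of_subsingleton N _ _ _ =>
    have : Subsingleton (FrobPush p 1 N) := inferInstanceAs (Subsingleton N)
    simp [Module.length_eq_zero]
  | @of_simple_quotient M _ _ N hs _ ih =>
    have h1 : Module.length R (FrobPush p 1 (M ⧸ N)) = residueDegree R p := by
      obtain ⟨I, hI, ⟨e⟩⟩ := isSimpleModule_iff_quot_maximal.1 hs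
      obtain rfl := IsLocalRing.eq_maximalIdeal hI
      rw [← length_one_residueField hF]
      exact (congr 1 e).length_eq
    rw [Module.length_eq_add_of_exact N.subtype N.mkQ N.subtype_injective N.mkQ_surjective
      (LinearMap.exact_subtype_mkQ N),
      Module.length_eq_add_of_exact (map (p := p) 1 N.subtype) (map (p := p) 1 N.mkQ)
      N.subtype_injective N.mkQ_surjective (LinearMap.exact_subtype_mkQ N), ih, h1, mul_add,
      Module.length_eq_one R (M ⧸ N), mul_one]

theorem length_eq (hF : (frobenius R p).Finite) (e : ℕ) {N : Type*} [AddCommGroup N] [Module R N]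
    (hN : Module.length R N ≠ ⊤) :
    Module.length R (FrobPush p e N) = (residueDegree R p : ℕ∞) ^ e * Module.length R N := by
  induction e generalizing N with
  | zero => rw [pow_zero, one_mul, zeroEquiv.length_eq]
  | succ e ih =>
    have h1 := length_one (p := p) hF (Module.length_ne_top_iff.1 hN)
    rw [← (addEquiv 1 e).length_eq, ih, h1, pow_succ, mul_assoc]
    rw [h1]
    exact WithTop.mul_ne_top (ENat.natCast_ne_top _) hN

theorem length_quotient_submodule (hF : (frobenius R p).Finite) (e : ℕ) {M : Type*}
    [AddCommGroup M] [Module R M] (S : Submodule R M) (hS : Module.length R (M ⧸ S) ≠ ⊤) :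
    Module.length R (FrobPush p e M ⧸ submodule (p := p) e S) =
      (residueDegree R p : ℕ∞) ^ e * Module.length R (M ⧸ S) := by
  rw [(quotientEquiv e S).length_eq, length_eq hF e hS]

end

end FrobPush

/-! ### Frobenius powers of ideals -/

section FrobeniusPower

variable {R : Type*} [CommRing R] (p : ℕ) [ExpChar R p]

/-- The Frobenius power `I^{[p^e]}` of an ideal. -/
def Ideal.frobeniusPower (e : ℕ) (I : Ideal R) : Ideal R := I.map (iterateFrobenius R p e)

variable {p}

theorem Ideal.pow_mem_frobeniusPower (e : ℕ) {I : Ideal R} {x : R} (hx : x ∈ I) :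
    x ^ p ^ e ∈ I.frobeniusPower p e :=
  Ideal.mem_map_of_mem (iterateFrobenius R p e) hx

theorem Ideal.frobeniusPower_le {e : ℕ} {I J : Ideal R} :
    I.frobeniusPower p e ≤ J ↔ ∀ x ∈ I, x ^ p ^ e ∈ J :=
  Ideal.map_le_iff_le_comap

theorem Ideal.frobeniusPower_le_pow (e : ℕ) (I : Ideal R) : I.frobeniusPower p e ≤ I ^ p ^ e :=
  Ideal.frobeniusPower_le.2 fun _ hx => Ideal.pow_mem_pow hx _

theorem Ideal.pow_mem_frobeniusPower_add {e f : ℕ} {I : Ideal R} {x : R}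
    (hx : x ∈ I.frobeniusPower p e) : x ^ p ^ f ∈ I.frobeniusPower p (e + f) := by
  suffices h : I.frobeniusPower p e ≤ (I.frobeniusPower p (e + f)).comap
      (iterateFrobenius R p f) from h hx
  refine Ideal.frobeniusPower_le.2 fun x hx => ?_
  rw [Ideal.mem_comap, iterateFrobenius_def, ← pow_mul, ← pow_add]
  exact Ideal.pow_mem_frobeniusPower _ hx

theorem FrobPush.frobeniusPower_smul_top_le (e f : ℕ) (I : Ideal R) :
    I.frobeniusPower p e • (⊤ : Submodule R (FrobPush p f R)) ≤
      FrobPush.submodule f (I.frobeniusPower p (e + f)) := by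
  rw [Submodule.smul_le]
  intro r hr x _
  rw [FrobPush.smul_eq, FrobPush.mem_submodule]
  exact Ideal.mul_mem_right _ _ (Ideal.pow_mem_frobeniusPower_add hr)

end FrobeniusPower

theorem span_sup_smul_top_le {R B : Type*} [CommRing R] [AddCommGroup B] [Module R B] {c : R}
    {J : Ideal R}
    {S T : Submodule R B} (hS : ∀ b : B, c • b ∈ S) (hT : J • (⊤ : Submodule R B) ≤ T) :
    (Ideal.span {c} ⊔ J) • (⊤ : Submodule R B) ≤ S ⊔ T := by
  rw [Submodule.sup_smul]
  refine sup_le_sup ?_ hT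
  rw [Submodule.ideal_span_singleton_smul]
  rintro _ ⟨b, _, rfl⟩
  exact hS b

/-! ### Hilbert-Kunz estimates -/

section HilbertKunz

open IsLocalRing

variable {R : Type*} [CommRing R] [IsLocalRing R] [IsNoetherianRing R] (p : ℕ) [Fact p.Prime]
  [CharP R p]

variable (R) in
-- `𝔪^{[q]}` contains the `q`-th powers of a system of parameters.
theorem exists_length_frobeniusPower_le : ∃ K : ℕ, ∀ e : ℕ,
    Module.length R (R ⧸ (maximalIdeal R).frobeniusPower p e) ≤
      K * ((p : ℕ∞) ^ e) ^ localDim R := by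
  obtain ⟨s, hs, hsm, hfin⟩ := exists_parameters R
  refine ⟨(Module.length R (R ⧸ Ideal.span (s : Set R))).toNat, fun e => ?_⟩
  have h := Ideal.length_quotient_sup_span_pow_le s (p ^ e) ⊥
  rw [bot_sup_eq, bot_sup_eq, hs] at h
  rw [ENat.natCast_toNat hfin, mul_comm]
  push_cast at h
  refine le_trans (Module.length_quotient_le_of_le ?_) h
  rw [Ideal.span_le]
  rintro _ ⟨x, hx, rfl⟩
  exact Ideal.pow_mem_frobeniusPower e (hsm hx)

variable (R) in
theorem exists_le_length_frobeniusPower : ∃ s : ℕ, ∀ e : ℕ,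
    ((p : ℕ∞) ^ e) ^ localDim R ≤
      Module.length R (R ⧸ (maximalIdeal R).frobeniusPower p (e + s)) := by
  obtain ⟨l, hl⟩ := Order.le_krullDim_iff.1 (coe_localDim (R := R)).le
  obtain ⟨b, hb⟩ := exists_pow_le_length_quotient_sup_pow _ l hl
  have hp : 1 < p := (Fact.out : p.Prime).one_lt
  refine ⟨b, fun e => ?_⟩
  -- The shift by `b` suffices since `b < p ^ b` gives `𝔪^{[p^(e+b)]} ⊆ 𝔪 ^ (b * p ^ e)`.
  have := hb (p ^ e) (Nat.one_le_pow _ _ (by omega))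
  push_cast at this
  refine this.trans (Module.length_quotient_le_of_le ?_)
  refine le_trans (Ideal.frobeniusPower_le_pow _ _) (le_trans (Ideal.pow_le_pow_right ?_)
    le_sup_right)
  rw [pow_add, mul_comm]
  exact Nat.mul_le_mul le_rfl (Nat.lt_pow_self hp).le

theorem length_quotient_ne_top_of_frobeniusPower_smul_le {M : Type*} [AddCommGroup M] [Module R M]
    [Module.Finite R M] {e : ℕ} {S : Submodule R M}
    (h : (maximalIdeal R).frobeniusPower p e • (⊤ : Submodule R M) ≤ S) :
    Module.length R (M ⧸ S) ≠ ⊤ := by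
  obtain ⟨K, hK⟩ := exists_length_frobeniusPower_le R p
  obtain ⟨r, hr⟩ := Module.exists_length_quotient_smul_le (R := R) M
  refine ne_top_of_le_ne_top ?_ ((Module.length_quotient_le_of_le h).trans
    ((hr _).trans (mul_le_mul_right (hK e) _)))
  exact_mod_cast ENat.natCast_ne_top (r * (K * (p ^ e) ^ localDim R))

theorem length_quotient_ne_top_of_frobeniusPower_le {e : ℕ} {I : Ideal R}
    (h : (maximalIdeal R).frobeniusPower p e ≤ I) : Module.length R (R ⧸ I) ≠ ⊤ :=
  length_quotient_ne_top_of_frobeniusPower_smul_le p (M := R) (S := I) (e := e) (by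
    rwa [smul_eq_mul, Ideal.mul_top])

variable [IsDomain R]

/-- Modulo `c` at most `d - 1` parameters are needed, so the length is `O(q ^ (d - 1))`; it is
multiplied by `q` to avoid the subtraction. If `c` is a unit, the quotient vanishes. -/
theorem exists_length_sup_frobeniusPower_le {c : R} (hc : c ≠ 0) : ∃ K : ℕ, ∀ e : ℕ,
    (p : ℕ∞) ^ e * Module.length R (R ⧸ (Ideal.span {c} ⊔ (maximalIdeal R).frobeniusPower p e)) ≤
      K * ((p : ℕ∞) ^ e) ^ localDim R := by
  by_cases hcm : c ∈ maximalIdeal R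
  · obtain ⟨s, hs, hsm, hfin⟩ := exists_parameters_quotient hcm hc
    refine ⟨(Module.length R (R ⧸ (Ideal.span {c} ⊔ Ideal.span (s : Set R)))).toNat,
      fun e => ?_⟩
    have h := Ideal.length_quotient_sup_span_pow_le s (p ^ e) (Ideal.span {c})
    push_cast at h
    rw [ENat.natCast_toNat hfin, mul_comm (Module.length _ _)]
    have hle : Ideal.span {c} ⊔ Ideal.span (Set.image (fun x => x ^ p ^ e) (s : Set R)) ≤
        Ideal.span {c} ⊔ (maximalIdeal R).frobeniusPower p e := by
      refine sup_le_sup_left ?_ _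
      rw [Ideal.span_le]
      rintro _ ⟨x, hx, rfl⟩
      exact Ideal.pow_mem_frobeniusPower e (hsm hx)
    refine (mul_le_mul_right ((Module.length_quotient_le_of_le hle).trans h) _).trans ?_
    rw [← mul_assoc, ← pow_succ']
    refine mul_le_mul_left ?_ _
    exact_mod_cast Nat.pow_le_pow_right (Nat.pos_of_ne_zero (NeZero.ne (p ^ e))) hs
  · refine ⟨0, fun e => ?_⟩
    have : Ideal.span {c} = ⊤ := Ideal.span_singleton_eq_top.2 (by simpa using hcm)
    rw [this, top_sup_eq, Module.length_eq_zero_iff.2 (Ideal.Quotient.subsingleton_iff.2 rfl)]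
    simp

/-- The torsion quotients of a finite module are small compared to `q ^ d`. -/
theorem exists_length_torsion_quotient_le (M : Type*) [AddCommGroup M] [Module R M]
    [Module.Finite R M] {c : R} (hc : c ≠ 0) : ∃ K : ℕ, ∀ e : ℕ,
    (p : ℕ∞) ^ e * Module.length R
      (M ⧸ (Ideal.span {c} ⊔ (maximalIdeal R).frobeniusPower p e) • (⊤ : Submodule R M)) ≤
      K * ((p : ℕ∞) ^ e) ^ localDim R := by
  obtain ⟨K, hK⟩ := exists_length_sup_frobeniusPower_le p hc
  obtain ⟨r, hr⟩ := Module.exists_length_quotient_smul_le (R := R) M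
  refine ⟨r * K, fun e => (mul_le_mul_right (hr _) _).trans ?_⟩
  rw [mul_left_comm, Nat.cast_mul, mul_assoc]
  exact mul_le_mul_right (hK e) _

/-- `g : R^r → M` carries `I^r` into `S`, and its cokernel is killed by `c`. The constant depends on
neither `I` nor `S`, so they may vary with `e`. -/
theorem exists_length_quotient_le_finrank_mul (M : Type*) [AddCommGroup M] [Module R M]
    [Module.Finite R M] : ∃ K : ℕ, ∀ (e : ℕ) (I : Ideal R) (S : Submodule R M),
      (maximalIdeal R).frobeniusPower p e ≤ I → I • (⊤ : Submodule R M) ≤ S →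
      (p : ℕ∞) ^ e * Module.length R (M ⧸ S) ≤
        (p : ℕ∞) ^ e * (Module.finrank R M * Module.length R (R ⧸ I)) +
          K * ((p : ℕ∞) ^ e) ^ localDim R := by
  obtain ⟨c, hc, g, h, hgh, -⟩ := Module.exists_quasi_inverse (R := R) M
  obtain ⟨K, hK⟩ := exists_length_torsion_quotient_le p M hc
  refine ⟨K, fun e I S hI hS => le_trans ?_ (add_le_add le_rfl (hK e))⟩
  rw [← mul_add, ← Module.length_pi_quotient]
  refine mul_le_mul_right (Module.length_quotient_le_add g (fun v hv => hS ?_) ?_) _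
  · rw [pi_eq_sum_univ v, map_sum]
    refine Submodule.sum_mem _ fun i _ => ?_
    rw [map_smul]
    exact Submodule.smul_mem_smul (hv i trivial) trivial
  · exact span_sup_smul_top_le (fun m => ⟨h m, hgh m⟩)
      ((Submodule.smul_mono_left hI).trans hS)

/-- The reverse comparison, along a map to the free module that sends `S` into `I^r` and has
cokernel killed by `c`. -/
theorem exists_mul_length_quotient_le {M : Type*} [AddCommGroup M] [Module R M]
    {r : ℕ} (h : M →ₗ[R] (Fin r → R)) {c : R} (hc : c ≠ 0)
    (hch : ∀ v, c • v ∈ LinearMap.range h) : ∃ K : ℕ, ∀ (e : ℕ) (I : Ideal R) (S : Submodule R M),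
      (maximalIdeal R).frobeniusPower p e ≤ I → (∀ x ∈ S, ∀ i, h x i ∈ I) →
      (p : ℕ∞) ^ e * (r * Module.length R (R ⧸ I)) ≤
        (p : ℕ∞) ^ e * Module.length R (M ⧸ S) + K * ((p : ℕ∞) ^ e) ^ localDim R := by
  obtain ⟨K, hK⟩ := exists_length_torsion_quotient_le p (Fin r → R) hc
  refine ⟨K, fun e I S hI hS => le_trans ?_ (add_le_add le_rfl (hK e))⟩
  rw [← mul_add, ← Module.length_pi_quotient]
  refine mul_le_mul_right (Module.length_quotient_le_add h
    (B' := Submodule.pi Set.univ fun _ => I) (fun v hv i _ => hS v hv i) ?_) _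
  refine span_sup_smul_top_le hch ?_
  rw [Submodule.smul_le]
  exact fun a ha v _ i _ => Ideal.mul_mem_right _ _ (hI ha)

end HilbertKunz

/-! ### Lower bound for the rank of the Frobenius pushforward -/

section Rank

open IsLocalRing

/-- A sequence that is eventually contracted up to a null sequence is not bounded below by a
positive constant. -/
theorem not_forall_le_of_contracting {u ε : ℕ → ℝ} {t δ : ℝ} (ht0 : 0 ≤ t) (ht : t < 1)
    (hδ : 0 < δ) (hε : Tendsto ε atTop (𝓝 0)) (hu : ∀ j, u (j + 1) ≤ t * u j + ε j) :
    ¬ ∀ᶠ j in atTop, δ ≤ u j := by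
  intro hlow
  -- If `δ ≤ u j`, this error is at most `(1 - t) / 2 * u j`, so the contraction factor becomes `t +
  -- (1 - t) / 2 = (1 + t) / 2 < 1`.
  have h1 : ∀ᶠ j in atTop, ε j ≤ (1 - t) / 2 * δ :=
    hε.eventually_le_const (by nlinarith [mul_pos (sub_pos.2 ht) hδ])
  obtain ⟨j₀, hj₀⟩ := eventually_atTop.1 (hlow.and h1)
  have key : ∀ i, u (j₀ + i) ≤ ((1 + t) / 2) ^ i * u j₀ := by
    intro i
    induction i with
    | zero => simp
    | succ i ih =>
      have h2 := hj₀ (j₀ + i) (Nat.le_add_right _ _)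
      have h3 := hu (j₀ + i)
      rw [← add_assoc, pow_succ, mul_comm _ ((1 + t) / 2), mul_assoc]
      have h4 : (1 - t) / 2 * δ ≤ (1 - t) / 2 * u (j₀ + i) :=
        mul_le_mul_of_nonneg_left h2.1 (by linarith)
      have h5 := mul_le_mul_of_nonneg_left ih (by linarith : (0 : ℝ) ≤ (1 + t) / 2)
      linarith
  have hlim : Tendsto (fun i => ((1 + t) / 2) ^ i * u j₀) atTop (𝓝 (0 * u j₀)) :=
    (tendsto_pow_atTop_nhds_zero_of_lt_one (by linarith) (by linarith)).mul_const _
  rw [zero_mul] at hlim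
  have := ge_of_tendsto' hlim fun i => (hj₀ (j₀ + i) (Nat.le_add_right _ _)).1.trans (key i)
  linarith

variable {R : Type*} [CommRing R] [IsLocalRing R] [IsNoetherianRing R] [IsDomain R] {p : ℕ}
  [Fact p.Prime] [CharP R p]

/-- The rank of `F^f_* R` is at least `[k^{1/q} : k] * q ^ dim R`, `q = p ^ f`. -/
theorem residueDegree_pow_mul_le_finrank (hF : (frobenius R p).Finite) {f : ℕ} (hf : f ≠ 0) :
    FrobPush.residueDegree R p ^ f * (p ^ f) ^ localDim R ≤
      Module.finrank R (FrobPush p f R) := by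
  by_contra! hlt
  have := FrobPush.finite f (M := R) hF
  obtain ⟨K, hK⟩ := exists_length_quotient_le_finrank_mul (R := R) p (FrobPush p f R)
  obtain ⟨s, hs⟩ := exists_le_length_frobeniusPower R p
  set N := Module.finrank R (FrobPush p f R)
  set κ := FrobPush.residueDegree R p
  set d := localDim R
  have hκ : 0 < κ := FrobPush.residueDegree_pos hF
  have hp : 0 < p := (Fact.out : p.Prime).pos
  have hp1 : 1 < p := (Fact.out : p.Prime).one_lt
  have hfin : ∀ e, Module.length R (R ⧸ (maximalIdeal R).frobeniusPower p e) ≠ ⊤ := fun e =>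
    length_quotient_ne_top_of_frobeniusPower_le p le_rfl
  choose l hl using fun e => ENat.ne_top_iff_exists.1 (hfin e)
  -- Comparison of `F^f_* (R / 𝔪^{[p^(e+f)]})` with `N` copies of `R / 𝔪^{[p^e]}`.
  have hrec : ∀ e, p ^ e * (κ ^ f * l (e + f)) ≤ p ^ e * (N * l e) + K * (p ^ e) ^ d := by
    intro e
    have := hK e _ _ le_rfl (FrobPush.frobeniusPower_smul_top_le e f (maximalIdeal R))
    rw [FrobPush.length_quotient_submodule hF f _ (hfin _), ← hl, ← hl] at this
    exact_mod_cast this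
  have hlow : ∀ e, (p ^ e) ^ d ≤ l (e + s) := by
    intro e
    have := hs e
    rw [← hl] at this
    exact_mod_cast this
  have hpR : (0 : ℝ) < p := by exact_mod_cast hp
  have hκR : (0 : ℝ) < κ := by exact_mod_cast hκ
  have hD : (0 : ℝ) < (κ : ℝ) ^ f * ((p : ℝ) ^ f) ^ d := by positivity
  -- Normalized Hilbert-Kunz lengths along the multiples of `f`: the assumption on `N` says `t < 1`,
  -- and `δ` compensates the shift `s` of the lower bound.
  refine not_forall_le_of_contracting (u := fun j => (l (j * f) : ℝ) / ((p : ℝ) ^ (j * f)) ^ d)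
    (ε := fun j => K * ((p : ℝ)⁻¹ ^ f) ^ j / ((κ : ℝ) ^ f * ((p : ℝ) ^ f) ^ d))
    (t := N / ((κ : ℝ) ^ f * ((p : ℝ) ^ f) ^ d)) (δ := (((p : ℝ) ^ s) ^ d)⁻¹)
    (by positivity) ?_ (by positivity) ?_ ?_ ?_
  · rw [div_lt_one hD]
    exact_mod_cast hlt
  · have h0 : Tendsto (fun j => ((p : ℝ)⁻¹ ^ f) ^ j) atTop (𝓝 0) := by
      refine tendsto_pow_atTop_nhds_zero_of_lt_one (by positivity) ?_
      exact pow_lt_one₀ (by positivity) (inv_lt_one_of_one_lt₀ (by exact_mod_cast hp1)) hf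
    simpa using (h0.const_mul (K : ℝ)).div_const ((κ : ℝ) ^ f * ((p : ℝ) ^ f) ^ d)
  · intro j
    have h : (p : ℝ) ^ (j * f) * (κ ^ f * l (j * f + f)) ≤
        p ^ (j * f) * (N * l (j * f)) + K * (p ^ (j * f)) ^ d := by exact_mod_cast hrec (j * f)
    have e1 : ((p : ℝ)⁻¹ ^ f) ^ j = ((p : ℝ) ^ (j * f))⁻¹ := by
      rw [← pow_mul, mul_comm, inv_pow]
    rw [e1, add_mul, one_mul, pow_add]
    set q := (p : ℝ) ^ (j * f)
    have hq : 0 < q := by positivity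
    rw [div_mul_div_comm, div_add_div _ _ (by positivity) hD.ne', div_le_div_iff₀ (by positivity)
      (by positivity)]
    rw [← sub_nonneg] at h ⊢
    have : 0 ≤ (q * (N * l (j * f)) + K * q ^ d - q * (κ ^ f * l (j * f + f))) *
        (q⁻¹ * q ^ d * ((p : ℝ) ^ f) ^ d * ((κ : ℝ) ^ f * ((p : ℝ) ^ f) ^ d)) :=
      mul_nonneg h (by positivity)
    refine this.trans_eq ?_
    rw [mul_pow]
    field_simp
  · filter_upwards [eventually_ge_atTop s] with j hj
    have hjs : s ≤ j * f := hj.trans (Nat.le_mul_of_pos_right _ (Nat.pos_of_ne_zero hf))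
    obtain ⟨e, he⟩ := Nat.exists_eq_add_of_le' hjs
    rw [he, le_div_iff₀ (by positivity), pow_add, mul_pow, mul_comm, mul_assoc,
      mul_inv_cancel₀ (by positivity), mul_one]
    exact_mod_cast hlow e

end Rank

/-! ### One map generates the dual generically -/

section DualFrame

variable {R : Type*} [CommRing R] [IsDomain R] {p : ℕ} [ExpChar R p]

/-- With `q = p ^ f`, `z ^ q * t` is a multiple of `z`, so `z * φ(t) = φ(z ^ q * t) = 0`. -/
theorem FrobPush.eq_zero_of_forall_mul {f : ℕ} {φ : FrobPush p f R →ₗ[R] R} {z : R} (hz : z ≠ 0)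
    (h : ∀ y, φ (of p f R (y * z)) = 0) : φ = 0 := by
  ext x
  obtain ⟨t, rfl⟩ := (of p f R).surjective x
  have hq : p ^ f ≠ 0 := pow_ne_zero _ (expChar_pos R p).ne'
  have h1 := h (z ^ (p ^ f - 1) * t)
  have h2 : z ^ (p ^ f - 1) * t * z = z ^ p ^ f • t := by
    rw [mul_right_comm, ← pow_succ, Nat.sub_add_cancel (Nat.one_le_iff_ne_zero.2 hq), smul_eq_mul]
  rw [h2, ← smul_of, map_smul, smul_eq_mul] at h1
  simpa [hz] using h1

/-- A nonzero map `φ : F^f_* R → R` generates the dual of `F^f_* R` up to torsion. -/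
theorem FrobPush.exists_dual_frame (hF : (frobenius R p).Finite) {f : ℕ}
    {φ : FrobPush p f R →ₗ[R] R} (hφ : φ ≠ 0) :
    ∃ c : R, c ≠ 0 ∧ ∃ h : FrobPush p f R →ₗ[R] (Fin (Module.finrank R (FrobPush p f R)) → R),
      (∀ v, c • v ∈ LinearMap.range h) ∧
      ∀ i, ∃ a : R, ∀ r, h (of p f R r) i = φ (of p f R (a * r)) := by
  have := FrobPush.finite f (M := R) hF
  obtain ⟨c, hc, g, h, hgh, hhg⟩ := Module.exists_quasi_inverse (R := R) (FrobPush p f R)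
  let x : Fin (Module.finrank R (FrobPush p f R)) → R := fun i =>
    (of p f R).symm (g (Pi.single i 1))
  let h' : FrobPush p f R →ₗ[R] (Fin (Module.finrank R (FrobPush p f R)) → R) :=
    LinearMap.pi fun i => φ ∘ₗ FrobPush.map f (LinearMap.mulLeft R (x i))
  -- The Gram matrix of the form `(a, b) ↦ φ(a * b)` in the generic basis `x` of `F^f_* R`.
  let A := LinearMap.toMatrix' (h' ∘ₗ g)
  have hA : ∀ v, A.mulVec v = h' (g v) := fun v => LinearMap.toMatrix'_mulVec (h' ∘ₗ g) v
  refine ⟨A.det, ?_, h', fun v => ?_, fun i => ⟨x i, fun r => rfl⟩⟩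
  · intro hdet
    obtain ⟨v, hv, hv0⟩ := Matrix.exists_mulVec_eq_zero_iff.2 hdet
    rw [hA] at hv0
    let z := (of p f R).symm (g v)
    have hz : z ≠ 0 := by
      intro hz
      have hgv : g v = 0 := (of p f R).symm.injective (hz.trans (map_zero _).symm)
      have := hhg v
      rw [hgv, map_zero, eq_comm, smul_eq_zero] at this
      exact this.elim hc hv
    -- A kernel vector gives `z ≠ 0` with `φ(x i * z) = 0` for all `i`. Since `c` moves every `y`
    -- into the span of the `x i`, `φ(y * z) = 0` for all `y`.
    refine hφ (FrobPush.eq_zero_of_forall_mul hz fun y => ?_)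
    let ψ : FrobPush p f R →ₗ[R] R := φ ∘ₗ FrobPush.map f (LinearMap.mulRight R z)
    have hψ : ψ ∘ₗ g = 0 := by
      refine LinearMap.pi_ext' fun i => LinearMap.ext_ring ?_
      have : φ (of p f R (x i * z)) = 0 := congr_fun hv0 i
      exact this
    have h1 := LinearMap.congr_fun hψ (h (of p f R y))
    rw [LinearMap.comp_apply, hgh, map_smul, smul_eq_mul, LinearMap.zero_apply] at h1
    exact (mul_eq_zero.1 h1).resolve_left hc
  -- The adjugate inverts `A` up to the scalar `A.det`.
  · refine ⟨g (A.adjugate.mulVec v), ?_⟩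
    rw [← hA, Matrix.mulVec_mulVec, Matrix.mul_adjugate, Matrix.smul_mulVec, Matrix.one_mulVec]

end DualFrame

/-! ### Splitting numbers as colengths -/

section SplittingNumber

open IsLocalRing

variable {R : Type*} [CommRing R] [IsLocalRing R] {p : ℕ} [Fact p.Prime] [CharP R p]

/-- The splitting number in terms of the elements all of whose images are in the maximal ideal. -/
theorem FlatSubmodule.splittingNumber_eq (hF : (frobenius R p).Finite) {C : CartierSubalgebra R p}
    {M : Type*} [AddCommGroup M] [Module R M] (𝓜 : FlatSubmodule C M) {e : ℕ} {S : Submodule R M}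
    (hS : ∀ m, m ∈ S ↔ ∀ ϑ ∈ 𝓜.deg e, ϑ (FrobPush.of p e M m) ∈ maximalIdeal R)
    (hfin : Module.length R (M ⧸ S) ≠ ⊤) :
    𝓜.splittingNumber e = (FrobPush.residueDegree R p : ℕ∞) ^ e * Module.length R (M ⧸ S) := by
  rw [← FrobPush.length_quotient_submodule hF e S hfin]
  have : FrobPush.submodule e S = maximalOrthogonal (𝓜.deg e) := by
    ext x
    exact hS x
  rw [this]
  exact length_quotient_eq_length_quotient_maximalOrthogonal _ _ fun _ => Iff.rfl

namespace CartierSubalgebra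

variable (C : CartierSubalgebra R p)

/-- The ideal `I_e` of the elements `r` with `φ (F^e_* r) ∈ 𝔪` for all `φ ∈ C_e`. -/
def splittingIdeal (e : ℕ) : Ideal R where
  carrier := {r | ∀ φ ∈ C.deg e, φ (FrobPush.of p e R r) ∈ maximalIdeal R}
  add_mem' ha hb φ hφ := by rw [map_add, map_add]; exact add_mem (ha φ hφ) (hb φ hφ)
  zero_mem' φ _ := by rw [map_zero, map_zero]; exact zero_mem _
  -- `φ(F^e_* (a * -))` is the product of `φ` with `a ∈ C_0`, hence lies in `C_e`.
  smul_mem' a r hr φ hφ :=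
    hr (FrobPush.comp φ (a • (FrobPush.zeroEquiv (p := p) (R := R) (M := R)).toLinearMap))
      (C.comp_mem (e := 0) hφ (by rw [C.deg_zero]; trivial))

/-- The elements of `M` that all functionals map into `I_e`. -/
def splittingSubmodule (M : Type*) [AddCommGroup M] [Module R M] (e : ℕ) : Submodule R M where
  carrier := {m | ∀ ρ : M →ₗ[R] R, ρ m ∈ C.splittingIdeal e}
  add_mem' ha hb ρ := by rw [map_add]; exact add_mem (ha ρ) (hb ρ)
  zero_mem' ρ := by rw [map_zero]; exact zero_mem _
  smul_mem' a m hm ρ := by rw [map_smul]; exact Ideal.mul_mem_left _ _ (hm ρ)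

theorem frobeniusPower_le_splittingIdeal (e : ℕ) :
    (maximalIdeal R).frobeniusPower p e ≤ C.splittingIdeal e := by
  refine Ideal.frobeniusPower_le.2 fun x hx φ _ => ?_
  have : FrobPush.of p e R (x ^ p ^ e) = x • FrobPush.of p e R 1 := by
    rw [FrobPush.smul_of, smul_eq_mul, mul_one]
  rw [this, map_smul]
  exact Ideal.mul_mem_right _ _ hx

variable {M : Type*} [AddCommGroup M] [Module R M]

theorem splittingIdeal_smul_top_le (e : ℕ) :
    C.splittingIdeal e • (⊤ : Submodule R M) ≤ C.splittingSubmodule M e := by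
  rw [Submodule.smul_le]
  intro r hr m _ ρ
  rw [map_smul]
  exact Ideal.mul_mem_right _ _ hr

theorem mem_splittingSubmodule_iff (e : ℕ) (m : M) : m ∈ C.splittingSubmodule M e ↔
    ∀ ϑ ∈ (C.natural M).deg e, ϑ (FrobPush.of p e M m) ∈ maximalIdeal R := by
  constructor
  · intro hm ϑ hϑ
    refine AddSubgroup.closure_induction
      (p := fun ϑ _ => ϑ (FrobPush.of p e M m) ∈ maximalIdeal R) ?_ ?_ ?_ ?_ hϑ
    · rintro _ ⟨φ, hφ, ρ, rfl⟩
      exact hm ρ φ hφ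
    · exact zero_mem _
    · intro x y _ _ hx hy
      exact add_mem hx hy
    · intro x _ hx
      exact neg_mem hx
  · intro h ρ φ hφ
    exact h (φ ∘ₗ FrobPush.map e ρ) (AddSubgroup.subset_closure ⟨φ, hφ, ρ, rfl⟩)

section Noetherian

variable [IsNoetherianRing R]

theorem length_splittingIdeal_ne_top (e : ℕ) :
    Module.length R (R ⧸ C.splittingIdeal e) ≠ ⊤ :=
  length_quotient_ne_top_of_frobeniusPower_le p (C.frobeniusPower_le_splittingIdeal e)

theorem self_splittingNumber (hF : (frobenius R p).Finite) (e : ℕ) : C.self.splittingNumber e =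
    (FrobPush.residueDegree R p : ℕ∞) ^ e * Module.length R (R ⧸ C.splittingIdeal e) :=
  C.self.splittingNumber_eq hF (fun _ => Iff.rfl) (C.length_splittingIdeal_ne_top e)

theorem length_splittingSubmodule_ne_top [Module.Finite R M] (e : ℕ) :
    Module.length R (M ⧸ C.splittingSubmodule M e) ≠ ⊤ :=
  length_quotient_ne_top_of_frobeniusPower_smul_le p
    ((Submodule.smul_mono_left (C.frobeniusPower_le_splittingIdeal e)).trans
      (C.splittingIdeal_smul_top_le e))

theorem natural_splittingNumber [Module.Finite R M] (hF : (frobenius R p).Finite) (e : ℕ) :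
    (C.natural M).splittingNumber e =
      (FrobPush.residueDegree R p : ℕ∞) ^ e * Module.length R (M ⧸ C.splittingSubmodule M e) :=
  (C.natural M).splittingNumber_eq hF (C.mem_splittingSubmodule_iff e)
    (C.length_splittingSubmodule_ne_top e)

end Noetherian

/-- The degrees in which `C` has a splitting form a semigroup. -/
def splittingDegrees : AddSubmonoid ℕ where
  carrier := {e | C.splittingIdeal e ≠ ⊤}
  zero_mem' := by
    rw [Set.mem_ofPred_eq, Ideal.ne_top_iff_one]
    intro h
    have := h (FrobPush.zeroEquiv (p := p) (R := R) (M := R)).toLinearMap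
      (by rw [C.deg_zero]; trivial)
    exact (Ideal.ne_top_iff_one _).1 (maximalIdeal.isMaximal R).ne_top this
  add_mem' {d e} hd he := by
    rw [Set.mem_ofPred_eq, Ideal.ne_top_iff_one] at he ⊢
    intro h
    obtain ⟨ψ, hψ, hu⟩ : ∃ ψ ∈ C.deg e, ψ (FrobPush.of p e R 1) ∉ maximalIdeal R := by
      by_contra! hc
      exact he hc
    have hu' : IsUnit (ψ (FrobPush.of p e R 1)) := by simpa using hu
    -- If `1 ∈ I_{d+e}`, composing every `φ ∈ C_d` with `ψ` puts the unit `ψ(F^e_* 1)` into `I_d`.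
    exact hd (Ideal.eq_top_of_isUnit_mem _ (fun φ hφ => h _ (C.comp_mem hφ hψ)) hu')

theorem mem_splittingDegrees {e : ℕ} : e ∈ C.splittingDegrees ↔ C.splittingIdeal e ≠ ⊤ := Iff.rfl

theorem splittingNumber_eq_zero_iff [IsNoetherianRing R] (hF : (frobenius R p).Finite) (e : ℕ) :
    C.self.splittingNumber e = 0 ↔ C.splittingIdeal e = ⊤ := by
  rw [C.self_splittingNumber hF, mul_eq_zero, or_iff_right, Module.length_eq_zero_iff,
    Ideal.Quotient.subsingleton_iff]
  exact pow_ne_zero _ (by exact_mod_cast (FrobPush.residueDegree_pos hF).ne')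

theorem splittingSubmodule_eq_top {e : ℕ} (h : C.splittingIdeal e = ⊤) :
    C.splittingSubmodule M e = ⊤ := by
  rw [eq_top_iff]
  intro m _ ρ
  rw [h]
  trivial

variable [IsNoetherianRing R] [IsDomain R]

/-- A nonzero `φ ∈ C_f` yields a map from `F^f_* R` to a free module of the same rank, with torsion
cokernel, that sends `F^f_* I_{e+f}` into copies of `I_e`; the rank is then bounded below. -/
theorem exists_length_splittingIdeal_le (hF : (frobenius R p).Finite) {f : ℕ} (hf : f ≠ 0)
    (hC : C.splittingIdeal f ≠ ⊤) : ∃ K : ℕ, ∀ e : ℕ,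
    (p : ℕ∞) ^ e * ((FrobPush.residueDegree R p ^ f * (p ^ f) ^ localDim R : ℕ) *
        Module.length R (R ⧸ C.splittingIdeal e)) ≤
      (p : ℕ∞) ^ e * ((FrobPush.residueDegree R p : ℕ∞) ^ f *
        Module.length R (R ⧸ C.splittingIdeal (e + f))) + K * ((p : ℕ∞) ^ e) ^ localDim R := by
  obtain ⟨φ, hφ, hφ0⟩ : ∃ φ ∈ C.deg f, φ ≠ 0 := by
    by_contra! hc
    refine hC ((Ideal.eq_top_iff_one _).2 fun φ hφ => ?_)
    rw [hc φ hφ]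
    exact zero_mem _
  obtain ⟨c, hc, h, hch, hh⟩ := FrobPush.exists_dual_frame hF hφ0
  obtain ⟨K, hK⟩ := exists_mul_length_quotient_le p h hc hch
  refine ⟨K, fun e => ?_⟩
  have h1 := hK e (C.splittingIdeal e) (FrobPush.submodule f (C.splittingIdeal (e + f)))
    (C.frobeniusPower_le_splittingIdeal e) ?_
  · rw [FrobPush.length_quotient_submodule hF f _ (C.length_splittingIdeal_ne_top _)] at h1
    refine le_trans (mul_le_mul_right (mul_le_mul_left ?_ _) _) h1
    exact_mod_cast residueDegree_pow_mul_le_finrank hF hf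
  · intro x hx i
    obtain ⟨a, ha⟩ := hh i
    obtain ⟨r, rfl⟩ := (FrobPush.of p f R).surjective x
    rw [ha]
    intro ψ hψ
    exact (C.splittingIdeal (e + f)).mul_mem_left a hx _ (C.comp_mem hψ hφ)

theorem exists_length_splittingSubmodule_le [Module.Finite R M] :
    ∃ K : ℕ, ∀ e : ℕ,
      (p : ℕ∞) ^ e * Module.length R (M ⧸ C.splittingSubmodule M e) ≤
        (p : ℕ∞) ^ e * (Module.finrank R M * Module.length R (R ⧸ C.splittingIdeal e)) +
          K * ((p : ℕ∞) ^ e) ^ localDim R := by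
  obtain ⟨K, hK⟩ := exists_length_quotient_le_finrank_mul (R := R) p M
  exact ⟨K, fun e => hK e _ _ (C.frobeniusPower_le_splittingIdeal e)
    (C.splittingIdeal_smul_top_le e)⟩

theorem exists_le_length_splittingSubmodule [Module.Finite R M] :
    ∃ K : ℕ, ∀ e : ℕ,
      (p : ℕ∞) ^ e * (Module.finrank R M * Module.length R (R ⧸ C.splittingIdeal e)) ≤
        (p : ℕ∞) ^ e * Module.length R (M ⧸ C.splittingSubmodule M e) +
          K * ((p : ℕ∞) ^ e) ^ localDim R := by
  obtain ⟨c, hc, g, h, -, hhg⟩ := Module.exists_quasi_inverse (R := R) M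
  -- The coordinates of `h` are functionals on `M`, so they send `S_e` into `I_e` by definition.
  obtain ⟨K, hK⟩ := exists_mul_length_quotient_le p h hc fun v => ⟨g v, hhg v⟩
  exact ⟨K, fun e => hK e _ _ (C.frobeniusPower_le_splittingIdeal e)
    fun x hx i => hx (LinearMap.proj i ∘ₗ h)⟩

end CartierSubalgebra

end SplittingNumber

/-! ### Convergence of almost increasing sequences -/

section Limits

/-- A bounded sequence that increases along all large steps converges. -/
theorem exists_tendsto_of_le_add {w : ℕ → ℝ} {B : ℝ} (hB : ∀ j, w j ≤ B) {N : ℕ}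
    (h : ∀ s ≥ N, ∀ j, w j ≤ w (j + s)) : ∃ r, Tendsto w atTop (𝓝 r) := by
  have hbdd : BddAbove (Set.range w) := ⟨B, by rintro _ ⟨j, rfl⟩; exact hB j⟩
  refine ⟨⨆ j, w j, tendsto_order.2 ⟨fun a ha => ?_, fun a ha => ?_⟩⟩
  · obtain ⟨j, hj⟩ := exists_lt_of_lt_ciSup ha
    filter_upwards [eventually_ge_atTop (j + N)] with i hi
    obtain ⟨s, rfl⟩ := Nat.exists_eq_add_of_le ((Nat.le_add_right _ _).trans hi)
    exact hj.trans_le (h s (by omega) j)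
  · exact Eventually.of_forall fun j => (le_ciSup hbdd j).trans_lt ha

theorem tendsto_const_div_pow_mul {p n : ℕ} (hp : 1 < p) (hn : n ≠ 0) (K : ℝ) :
    Tendsto (fun j : ℕ => K / (p : ℝ) ^ (j * n)) atTop (𝓝 0) := by
  have h1 : Tendsto (fun j : ℕ => ((p : ℝ) ^ n) ^ j) atTop atTop :=
    tendsto_pow_atTop_atTop_of_one_lt (one_lt_pow₀ (by exact_mod_cast hp) hn)
  refine (h1.const_div_atTop K).congr fun j => ?_
  rw [← pow_mul, mul_comm]

/-- A bounded sequence that increases, up to a geometric error, along every step in a semigroup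
`Γ` converges along the multiples of `gcd Γ`. -/
theorem exists_tendsto_of_le_add_div {p : ℕ} (hp : 1 < p) {u : ℕ → ℝ} {B : ℝ} (hB : ∀ e, u e ≤ B)
    (Γ : AddSubmonoid ℕ) (hΓ : ∀ f ∈ Γ, f ≠ 0 → ∃ K : ℕ, ∀ e, u e ≤ u (e + f) + K / (p : ℝ) ^ e)
    (hn : Nat.setGcd (Γ : Set ℕ) ≠ 0) :
    ∃ r, Tendsto (fun j => u (j * Nat.setGcd (Γ : Set ℕ))) atTop (𝓝 r) := by
  set n := Nat.setGcd (Γ : Set ℕ)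
  have hpR : (2 : ℝ) ≤ p := by exact_mod_cast hp
  obtain ⟨N, hN⟩ := Nat.exists_mem_closure_of_ge (Γ : Set ℕ)
  rw [AddSubmonoid.closure_eq] at hN
  have hle : ∀ a, a ≤ a * n := fun a => Nat.le_mul_of_pos_right a (Nat.pos_of_ne_zero hn)
  have hmem : ∀ a, N ≤ a → a * n ∈ Γ := fun a ha => hN _ (ha.trans (hle a)) (dvd_mul_left _ _)
  -- The constant depends on the step, so only two steps are used; consecutive multiples of `n`
  -- already have gcd `n`.
  obtain ⟨K₁, hK₁⟩ := hΓ _ (hmem (N + 1) (by omega)) (by positivity)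
  obtain ⟨K₂, hK₂⟩ := hΓ _ (hmem (N + 2) (by omega)) (by positivity)
  let K : ℝ := max K₁ K₂
  have hK : 0 ≤ K := le_max_of_le_left (Nat.cast_nonneg _)
  -- As `p ^ f ≥ 2`, the correction drops by at least `K / p ^ e` along a step `f`, which absorbs
  -- the error and makes `b` increase along it.
  let b : ℕ → ℝ := fun e => u e - 2 * K / (p : ℝ) ^ e
  let S : AddSubmonoid ℕ :=
    { carrier := {s | ∀ e, b e ≤ b (e + s)}
      zero_mem' := fun e => le_rfl
      add_mem' := fun {s t} hs ht e => (hs e).trans ((ht (e + s)).trans (by rw [add_assoc])) }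
  have hS : ∀ {f : ℕ} {k : ℕ}, f ≠ 0 → (k : ℝ) ≤ K →
      (∀ e, u e ≤ u (e + f) + k / (p : ℝ) ^ e) → f ∈ S := by
    intro f k hf hk h e
    have hpe : (0 : ℝ) < (p : ℝ) ^ e := by positivity
    have h1 : (k : ℝ) / (p : ℝ) ^ e ≤ K / (p : ℝ) ^ e := by gcongr
    have h2 : 2 * K / (p : ℝ) ^ (e + f) ≤ K / (p : ℝ) ^ e := by
      rw [pow_add, div_le_div_iff₀ (by positivity) hpe]
      have : (2 : ℝ) ≤ (p : ℝ) ^ f := hpR.trans (le_self_pow₀ (by linarith) hf)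
      nlinarith [mul_nonneg hK hpe.le, mul_le_mul_of_nonneg_left this (mul_nonneg hK hpe.le)]
    have h3 : 2 * K / (p : ℝ) ^ e = K / (p : ℝ) ^ e + K / (p : ℝ) ^ e := by ring
    have := h e
    change u e - 2 * K / (p : ℝ) ^ e ≤ u (e + f) - 2 * K / (p : ℝ) ^ (e + f)
    linarith
  have hS₁ : (N + 1) * n ∈ S := hS (by positivity) (le_max_left _ _) hK₁
  have hS₂ : (N + 2) * n ∈ S := hS (by positivity) (le_max_right _ _) hK₂
  let T : Set ℕ := {(N + 1) * n, (N + 2) * n}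
  have hTS : AddSubmonoid.closure T ≤ S := by
    rw [AddSubmonoid.closure_le]
    rintro _ (rfl | rfl)
    exacts [hS₁, hS₂]
  have hTn : Nat.setGcd T ∣ n := by
    have h1 : Nat.setGcd T ∣ (N + 1) * n := Nat.setGcd_dvd_of_mem (Or.inl rfl)
    have h2 : Nat.setGcd T ∣ (N + 2) * n := Nat.setGcd_dvd_of_mem (Or.inr rfl)
    have h3 := Nat.dvd_sub h2 h1
    rwa [← Nat.sub_mul, show N + 2 - (N + 1) = 1 by omega, one_mul] at h3
  obtain ⟨N', hN'⟩ := Nat.exists_mem_closure_of_ge T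
  obtain ⟨r, hr⟩ := exists_tendsto_of_le_add (w := fun j => b (j * n)) (B := B) (N := N')
    (fun j => (sub_le_self _ (by positivity)).trans (hB _))
    (fun s hs j => by
      have := hTS (hN' (s * n) (hs.le.trans (hle s)) (hTn.mul_left s)) (j * n)
      rwa [← add_mul] at this)
  refine ⟨r, ?_⟩
  have := hr.add (tendsto_const_div_pow_mul hp hn (2 * K))
  simpa [b] using this

theorem div_le_div_add_div {x y K q D : ℝ} (hq : 0 < q) (hD : 0 < D)
    (h : q * x ≤ q * y + K * D) : x / D ≤ y / D + K / q := by
  rw [div_add_div _ _ hD.ne' hq.ne', div_le_div_iff₀ hD (by positivity)]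
  nlinarith [mul_le_mul_of_nonneg_right h hD.le]

end Limits

/-! ### Normalized lengths and splitting ratios -/

section SplittingRatio

variable {R : Type*} [CommRing R] [IsLocalRing R] {p : ℕ} [Fact p.Prime] [CharP R p]

theorem rpow_deltaExp (hF : (frobenius R p).Finite) (e : ℕ) :
    ((p : ℝ) ^ e) ^ deltaExp R p =
      (FrobPush.residueDegree R p : ℝ) ^ e * ((p : ℝ) ^ e) ^ localDim R := by
  have hp : 1 < p := (Fact.out : p.Prime).one_lt
  have hpR : (1 : ℝ) < p := by exact_mod_cast hp
  have hp0 : (0 : ℝ) < p := by linarith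
  have hκ : (0 : ℝ) < FrobPush.residueDegree R p := by
    exact_mod_cast FrobPush.residueDegree_pos hF
  rw [deltaExp, Real.rpow_add (by positivity), Real.rpow_natCast, mul_comm]
  congr 1
  rw [← Real.rpow_natCast (p : ℝ) e, ← Real.rpow_mul hp0.le, mul_comm, Real.rpow_mul hp0.le,
    Real.rpow_natCast]
  exact congrArg (· ^ e) (Real.rpow_logb hp0 hpR.ne' hκ)

theorem FlatSubmodule.splittingSeq_eq (hF : (frobenius R p).Finite) {C : CartierSubalgebra R p}
    {M : Type*} [AddCommGroup M] [Module R M] (𝓜 : FlatSubmodule C M) {l : ℕ → ℕ∞}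
    (hl : ∀ e, 𝓜.splittingNumber e = (FrobPush.residueDegree R p : ℕ∞) ^ e * l e) (j : ℕ) :
    𝓜.splittingSeq j =
      ((l (j * 𝓜.period)).toNat : ℝ) / ((p : ℝ) ^ (j * 𝓜.period)) ^ localDim R := by
  have hκ : (FrobPush.residueDegree R p : ℝ) ≠ 0 := by
    exact_mod_cast (FrobPush.residueDegree_pos hF).ne'
  rw [FlatSubmodule.splittingSeq, rpow_deltaExp hF, hl, ENat.toNat_mul, ← Nat.cast_pow,
    ENat.toNat_natCast]
  push_cast
  rw [mul_div_mul_left _ _ (pow_ne_zero _ hκ)]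

variable [IsNoetherianRing R] (C : CartierSubalgebra R p)

namespace CartierSubalgebra

/-- The normalized length `length (R / I_e) / p ^ (e * dim R)`. -/
def idealRatio (e : ℕ) : ℝ :=
  ((Module.length R (R ⧸ C.splittingIdeal e)).toNat : ℝ) / ((p : ℝ) ^ e) ^ localDim R

/-- The normalized length of `M / {m | ρ m ∈ I_e for all ρ}`. -/
def moduleRatio (M : Type*) [AddCommGroup M] [Module R M] (e : ℕ) : ℝ :=
  ((Module.length R (M ⧸ C.splittingSubmodule M e)).toNat : ℝ) / ((p : ℝ) ^ e) ^ localDim R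

theorem exists_idealRatio_le : ∃ B : ℝ, ∀ e, C.idealRatio e ≤ B := by
  obtain ⟨K, hK⟩ := exists_length_frobeniusPower_le R p
  have hp : 0 < p := (Fact.out : p.Prime).pos
  refine ⟨K, fun e => ?_⟩
  have h := (Module.length_quotient_le_of_le (C.frobeniusPower_le_splittingIdeal e)).trans (hK e)
  rw [← ENat.natCast_toNat (C.length_splittingIdeal_ne_top e)] at h
  rw [idealRatio, div_le_iff₀ (by positivity)]
  exact_mod_cast h

theorem setOf_splittingNumber_ne_zero (hF : (frobenius R p).Finite) :
    {e | C.self.splittingNumber e ≠ 0} = C.splittingDegrees := by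
  ext e
  exact (C.splittingNumber_eq_zero_iff hF e).not

/-- `I_e = R` forces `S_e = M`, so every splitting degree of `M^♮` is one of `C`. -/
theorem period_dvd_natural_period (hF : (frobenius R p).Finite) (M : Type*) [AddCommGroup M]
    [Module R M] [Module.Finite R M] : C.self.period ∣ (C.natural M).period := by
  refine Nat.setGcd_mono fun e he => ?_
  rw [setOf_splittingNumber_ne_zero C hF, SetLike.mem_coe, mem_splittingDegrees]
  intro h
  refine he ?_
  rw [C.natural_splittingNumber hF, C.splittingSubmodule_eq_top h,
    Module.length_eq_zero_iff.2 (Submodule.Quotient.subsingleton_iff.2 rfl), mul_zero]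

variable [IsDomain R]

theorem exists_idealRatio_le_add (hF : (frobenius R p).Finite) {f : ℕ} (hf : f ≠ 0)
    (hC : C.splittingIdeal f ≠ ⊤) :
    ∃ K : ℕ, ∀ e, C.idealRatio e ≤ C.idealRatio (e + f) + K / (p : ℝ) ^ e := by
  obtain ⟨K, hK⟩ := C.exists_length_splittingIdeal_le hF hf hC
  have hp : 0 < p := (Fact.out : p.Prime).pos
  have hpR : (0 : ℝ) < p := by exact_mod_cast hp
  refine ⟨K, fun e => ?_⟩
  have h := hK e
  rw [← ENat.natCast_toNat (C.length_splittingIdeal_ne_top e),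
    ← ENat.natCast_toNat (C.length_splittingIdeal_ne_top (e + f))] at h
  rw [idealRatio, idealRatio]
  set a := (Module.length R (R ⧸ C.splittingIdeal e)).toNat
  set a' := (Module.length R (R ⧸ C.splittingIdeal (e + f))).toNat
  set κ := FrobPush.residueDegree R p
  set d := localDim R
  have hκ : (1 : ℝ) ≤ κ := by exact_mod_cast FrobPush.residueDegree_pos hF
  have h' : (p : ℝ) ^ e * ((κ ^ f * (p ^ f) ^ d) * a) ≤
      p ^ e * (κ ^ f * a') + K * (p ^ e) ^ d := by exact_mod_cast h
  have hκf : (1 : ℝ) ≤ (κ : ℝ) ^ f := one_le_pow₀ hκ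
  have hpf : (1 : ℝ) ≤ ((p : ℝ) ^ f) ^ d := one_le_pow₀ (one_le_pow₀ (by exact_mod_cast hp))
  have h1 := div_le_div_add_div (by positivity) (by positivity : (0 : ℝ) < ((p : ℝ) ^ e) ^ d) h'
  have hQ : (1 : ℝ) ≤ (κ : ℝ) ^ f * ((p : ℝ) ^ f) ^ d := one_le_mul_of_one_le_of_one_le hκf hpf
  have hQ0 : (0 : ℝ) < (κ : ℝ) ^ f * ((p : ℝ) ^ f) ^ d := by linarith
  -- The factor `κ ^ f * p ^ (f * d)` is exactly the change of normalization from `e` to `e + f`;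
  -- being at least `1`, it may be restored on the error term.
  rw [pow_add, mul_pow, ← mul_le_mul_iff_of_pos_left hQ0, mul_add]
  have h2 : (K : ℝ) / (p : ℝ) ^ e ≤ (κ : ℝ) ^ f * ((p : ℝ) ^ f) ^ d * (K / (p : ℝ) ^ e) :=
    le_mul_of_one_le_left (by positivity) hQ
  refine le_trans (le_of_eq ?_) (h1.trans (add_le_add (le_of_eq ?_) h2))
  · rw [mul_div_assoc]
  · field_simp

theorem exists_abs_moduleRatio_sub_le (M : Type*) [AddCommGroup M] [Module R M]
    [Module.Finite R M] : ∃ K : ℝ, ∀ e,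
      |C.moduleRatio M e - Module.finrank R M * C.idealRatio e| ≤ K / (p : ℝ) ^ e := by
  obtain ⟨K₁, hK₁⟩ := C.exists_length_splittingSubmodule_le (M := M)
  obtain ⟨K₂, hK₂⟩ := C.exists_le_length_splittingSubmodule (M := M)
  have hp : 0 < p := (Fact.out : p.Prime).pos
  refine ⟨max K₁ K₂, fun e => ?_⟩
  have h₁ := hK₁ e
  have h₂ := hK₂ e
  rw [← ENat.natCast_toNat (C.length_splittingIdeal_ne_top e),
    ← ENat.natCast_toNat (C.length_splittingSubmodule_ne_top (M := M) e)] at h₁ h₂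
  rw [idealRatio, moduleRatio]
  set a := (Module.length R (R ⧸ C.splittingIdeal e)).toNat
  set a' := (Module.length R (M ⧸ C.splittingSubmodule M e)).toNat
  have h₁' : (p : ℝ) ^ e * a' ≤ p ^ e * (Module.finrank R M * a) +
      K₁ * (p ^ e) ^ localDim R := by exact_mod_cast h₁
  have h₂' : (p : ℝ) ^ e * (Module.finrank R M * a) ≤ p ^ e * a' +
      K₂ * (p ^ e) ^ localDim R := by exact_mod_cast h₂
  have hD : (0 : ℝ) < ((p : ℝ) ^ e) ^ localDim R := by positivity
  have g₁ := div_le_div_add_div (by positivity) hD h₁'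
  have g₂ := div_le_div_add_div (by positivity) hD h₂'
  have m₁ : (K₁ : ℝ) / (p : ℝ) ^ e ≤ max (K₁ : ℝ) K₂ / (p : ℝ) ^ e := by
    gcongr; exact le_max_left _ _
  have m₂ : (K₂ : ℝ) / (p : ℝ) ^ e ≤ max (K₁ : ℝ) K₂ / (p : ℝ) ^ e := by
    gcongr; exact le_max_right _ _
  rw [← mul_div_assoc, abs_sub_le_iff]
  constructor <;> linarith

theorem exists_tendsto_idealRatio (hF : (frobenius R p).Finite) (hn : C.self.period ≠ 0) :
    ∃ r, Tendsto (fun j => C.idealRatio (j * C.self.period)) atTop (𝓝 r) := by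
  obtain ⟨B, hB⟩ := C.exists_idealRatio_le
  have hper : C.self.period = Nat.setGcd (C.splittingDegrees : Set ℕ) := by
    rw [FlatSubmodule.period, setOf_splittingNumber_ne_zero C hF]
  rw [hper] at hn ⊢
  exact exists_tendsto_of_le_add_div (Fact.out : p.Prime).one_lt hB C.splittingDegrees
    (fun f hf hf0 => C.exists_idealRatio_le_add hF hf0 hf) hn

theorem tendsto_moduleRatio (M : Type*) [AddCommGroup M] [Module R M] [Module.Finite R M]
    {n : ℕ} (hn : n ≠ 0) {r : ℝ} (hr : Tendsto (fun j => C.idealRatio (j * n)) atTop (𝓝 r)) :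
    Tendsto (fun j => C.moduleRatio M (j * n)) atTop (𝓝 (Module.finrank R M * r)) := by
  obtain ⟨K, hK⟩ := C.exists_abs_moduleRatio_sub_le M
  have h0 : Tendsto (fun j => C.moduleRatio M (j * n) - Module.finrank R M * C.idealRatio (j * n))
      atTop (𝓝 0) :=
    squeeze_zero_norm (fun j => hK (j * n))
      (tendsto_const_div_pow_mul (Fact.out : p.Prime).one_lt hn K)
  simpa using h0.add (hr.const_mul (Module.finrank R M : ℝ))

end CartierSubalgebra

end SplittingRatio

end

theorem mainTheorem4 {R : Type*} [CommRing R] [IsDomain R] [IsLocalRing R]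
    [IsNoetherianRing R] {p : ℕ} [Fact p.Prime] [CharP R p]
    (hF : (frobenius R p).Finite) (C : CartierSubalgebra R p)
    (M : Type*) [AddCommGroup M] [Module R M] [Module.Finite R M] :
    C.self.SplittingRatioExists ∧ (C.natural M).SplittingRatioExists ∧
      (C.natural M).splittingRatio = (Module.finrank R M : ℝ) * C.fSignature := by
  obtain ⟨t, ht⟩ := C.period_dvd_natural_period hF M
  by_cases hn : C.self.period = 0
  · have hn' : (C.natural M).period = 0 := by rw [ht, hn, zero_mul]
    refine ⟨fun h => absurd hn h, fun h => absurd hn' h, ?_⟩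
    rw [CartierSubalgebra.fSignature, FlatSubmodule.splittingRatio, FlatSubmodule.splittingRatio,
      if_pos hn, if_pos hn', mul_zero]
  obtain ⟨r, hr⟩ := C.exists_tendsto_idealRatio hF hn
  have hself : Tendsto C.self.splittingSeq atTop (𝓝 r) :=
    hr.congr fun j => (C.self.splittingSeq_eq hF (C.self_splittingNumber hF) j).symm
  have hM := C.tendsto_moduleRatio M hn hr
  have hsig : C.fSignature = r := by
    rw [CartierSubalgebra.fSignature, FlatSubmodule.splittingRatio, if_neg hn]
    exact hself.limUnder_eq
  rw [hsig]
  by_cases hn' : (C.natural M).period = 0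
  -- Here `asr(M^♮)` is `0` by convention. All splitting numbers of `M^♮` in positive degrees
  -- vanish, so the limit `rank M * r` is `0` too; `j = 0` is excluded since degree `0` may split.
  · refine ⟨fun _ => ⟨r, hself⟩, fun h => absurd hn' h, ?_⟩
    rw [FlatSubmodule.splittingRatio, if_pos hn']
    refine tendsto_nhds_unique (tendsto_const_nhds.congr' ?_) hM
    filter_upwards [eventually_ge_atTop 1] with j hj
    have hzero : (C.natural M).splittingNumber (j * C.self.period) = 0 := by
      by_contra h
      have := Nat.setGcd_eq_zero_iff.1 hn' h
      exact absurd (Set.mem_singleton_iff.1 this) (Nat.mul_ne_zero (by omega) hn)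
    rw [C.natural_splittingNumber hF, mul_eq_zero, or_iff_right
      (pow_ne_zero _ (by exact_mod_cast (FrobPush.residueDegree_pos hF).ne'))] at hzero
    rw [CartierSubalgebra.moduleRatio, hzero]
    simp
  · have ht0 : t ≠ 0 := by rintro rfl; exact hn' (by rw [ht, mul_zero])
    -- The period of `M^♮` is `t` times that of `C`, so its sequence is a subsequence of a
    -- convergent one.
    have hnat : Tendsto (C.natural M).splittingSeq atTop (𝓝 (Module.finrank R M * r)) := by
      have hsub : Tendsto (fun j : ℕ => j * t) atTop atTop :=
        tendsto_id.atTop_mul_const' (Nat.pos_of_ne_zero ht0)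
      refine (hM.comp hsub).congr fun j => ?_
      rw [(C.natural M).splittingSeq_eq hF (C.natural_splittingNumber hF) j, ht,
        Function.comp_apply, CartierSubalgebra.moduleRatio, mul_assoc, mul_comm t]
    refine ⟨fun _ => ⟨r, hself⟩, fun _ => ⟨_, hnat⟩, ?_⟩
    rw [FlatSubmodule.splittingRatio, if_neg hn']
    exact hnat.limUnder_eq
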